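/- Let $p\ge 1$ be an integer. Let $c_1^\pm$ (even, $\langle 1\rangle=0$) and $c_2^\pm$ (odd, $\langle 2\rangle=1$) be operators, put $[\![a,b]\!]=ab-(-1)^{\deg a\deg b}\,ba$, and consider the parastatistics relations $$[\![[\![c_j^\xi,c_k^\eta]\!],c_l^\epsilon]\!]=-2\delta_{jl}\delta_{\epsilon,-\xi}\,\epsilon^{\langle l\rangle}(-1)^{\langle k\rangle\langle l\rangle}c_k^\eta+2\,\epsilon^{\langle l\rangle}\delta_{kl}\delta_{\epsilon,-\eta}\,c_j^\xi\qquad(j,k,l\in\{1,2\},\ \xi,\eta,\epsilon\in\{+,-\}).$$ A parastatistics Fock space $V(p)$ is a complex inner product space carrying an irreducible action of operators $c_j^\pm$ that satisfy these relations and $(c_j^\pm)^\dagger=c_j^\mp$, together with a vacuum vector $|0\rangle$ such that $\langle 0|0\rangle=1$, $c_j^-|0\rangle=0$ and $[\![c_j^-,c_k^+]\!]|0\rangle=p\,\delta_{jk}|0\rangle$. Then such a space exists, and every such space $V(p)$ has the following properties. (a) It has an orthonormal (algebraic) basis $|\mu)=|\mu_{12},\mu_{22};\mu_{11})$, where $\mu_{12},\mu_{22},\mu_{11}$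 are integers with $\mu_{22}\ge 0$, $0\le\mu_{12}\le p$ ($\mu_{12}\ge1$ if $\mu_{22}\ge 1$), $\theta=\mu_{12}-\mu_{11}\in\{0,1\}$ ($\theta=0$ if $\mu_{12}=0$), with $|0,0;0)=|0\rangle$, on which, with $\ell=\mu_{12}+\mu_{22}$ and with vectors whose labels are not allowed read as $0$, $$c_1^+|\mu)=\Big(\tfrac{\ell}{\ell+1}\Big)^{\theta/2}G_1(\mu_{12},\mu_{22})\,|\mu_{12}+1,\mu_{22};\mu_{11}+1)-\theta\Big(\tfrac1{\ell+1}\Big)^{1/2}G_2(\mu_{12},\mu_{22})\,|\mu_{12},\mu_{22}+1;\mu_{11}+1),$$ $$c_2^+|\mu)=(1-\theta)\Big(\tfrac1{\ell+1}\Big)^{1/2}G_1(\mu_{12},\mu_{22})\,|\mu_{12}+1,\mu_{22};\mu_{11})+(-1)^\theta\Big(\tfrac{\ell}{\mu_{11}+\mu_{22}+1}\Big)^{1/2}G_2(\mu_{12},\mu_{22})\,|\mu_{12},\mu_{22}+1;\mu_{11}),$$ and $c_j^-$ acts by the adjoint formulas $$c_1^-|\mu)=\Big(\tfrac{\ell-1}{\ell}\Big)^{\theta/2}G_1(\mu_{12}-1,\mu_{22})\,|\mu_{12}-1,\mu_{22};\mu_{11}-1)-(1-\theta)\Big(\tfrac1{\ell}\Big)^{1/2}G_2(\mu_{12},\mu_{22}-1)\,|\mu_{12},\mu_{22}-1;\mu_{11}-1),$$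 $$c_2^-|\mu)=\theta\Big(\tfrac1{\ell}\Big)^{1/2}G_1(\mu_{12}-1,\mu_{22})\,|\mu_{12}-1,\mu_{22};\mu_{11})+(-1)^\theta\Big(\tfrac{\ell-1}{\mu_{11}+\mu_{22}}\Big)^{1/2}G_2(\mu_{12},\mu_{22}-1)\,|\mu_{12},\mu_{22}-1;\mu_{11}).$$ Here $$G_1(a,b)=\sqrt{\frac{a(a+b+1)(p-a)}{a+b+1-\mathcal O_{b+1}}}\ \ (G_1(0,0)=\sqrt p),\qquad G_2(a,b)=\sqrt{\frac{(\mathcal O_b b+1)(\mathcal E_{b+1}(p+b)+1)(\mathcal O_{b+1}(a+b)+1)}{\mathcal E_{b+1}(a+b-1)+1}},$$ with $\mathcal E_j=1$ for even $j$ and $0$ otherwise, and $\mathcal O_j=1-\mathcal E_j$. (b) For every basis as in (a), each $|\mu)$ is an eigenvector of $h_1=-\tfrac12[c_1^-,c_1^+]$ and of $M_3=\tfrac12[c_1^-,c_1^+]=-h_1$: $$h_1|\mu)=\Big(-\frac p2+\mu_{11}\Big)|\mu),\qquad M_3|\mu)=\Big(\frac p2-\mu_{11}\Big)|\mu).$$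 (c) The set of eigenvalues of $M_3$ is exactly $\{\frac p2,\frac p2-1,\dots,-\frac p2\}$. (d) The oscillator has (maximal) angular momentum $M=\frac p2$: with $M_1=\frac12(c_1^++c_1^-)$, $M_2=-\frac i2(c_1^+-c_1^-)$ and $\mathbf M^2=M_1^2+M_2^2+M_3^2$, the largest real $j\ge 0$ such that $j(j+1)$ is an eigenvalue of $\mathbf M^2$ is $j=\frac p2$. -/

import Mathlib

noncomputable section

namespace Osp32

/-- The parity of the generators `c_1^±` (index `0`, parafermion, even) and
`c_2^±` (index `1`, paraboson, odd). -/
def deg (j : Fin 2) : ℕ := if j = 0 then 0 else 1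

/-- The superbracket `A B - (-1)^(d e) B A` of operators `A`, `B` of parities `d`, `e`. -/
def superBracket {V : Type*} [AddCommGroup V] [Module ℂ V] (d e : ℕ)
    (A B : Module.End ℂ V) : Module.End ℂ V :=
  A * B - ((-1 : ℂ) ^ (d * e)) • (B * A)

/-- The parastatistics relations of one parafermion pair and one paraboson pair.
The sign `ξ : ℤˣ` is `1` for a creation operator and `-1` for an annihilation operator. -/
def ParaRelations {V : Type*} [AddCommGroup V] [Module ℂ V]
    (c : Fin 2 → ℤˣ → Module.End ℂ V) : Prop :=
  ∀ (j k l : Fin 2) (ξ η ε : ℤˣ),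
    superBracket (deg j + deg k) (deg l)
        (superBracket (deg j) (deg k) (c j ξ) (c k η)) (c l ε) =
      (if j = l ∧ ε = -ξ then
          (-2 : ℂ) * (((ε : ℤ) : ℂ) ^ deg l) * ((-1 : ℂ) ^ (deg k * deg l)) else 0) • c k η +
      (if k = l ∧ ε = -η then (2 : ℂ) * (((ε : ℤ) : ℂ) ^ deg l) else 0) • c j ξ

/-- The structure of a parastatistics Fock space of order `p` on the complex inner product
space `V` (the algebraic state space, on which the possibly unbounded operators act). -/
structure ParaFockSpace (p : ℕ) (V : Type*) [NormedAddCommGroup V] [InnerProductSpace ℂ V] where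
  /-- the operators `c_j^ξ` -/
  c : Fin 2 → ℤˣ → Module.End ℂ V
  /-- the vacuum vector -/
  vac : V
  relations : ParaRelations c
  vac_inner : inner ℂ vac vac = (1 : ℂ)
  annihilate : ∀ j, c j (-1) vac = 0
  adjoint : ∀ j ξ x y, inner ℂ (c j ξ x) y = (inner ℂ x (c j (-ξ) y) : ℂ)
  order : ∀ j k, superBracket (deg j) (deg k) (c j (-1)) (c k 1) vac =
    (if j = k then (p : ℂ) else 0) • vac
  irreducible : ∀ W : Submodule ℂ V,
    (∀ j ξ, ∀ x ∈ W, c j ξ x ∈ W) → W = ⊥ ∨ W = ⊤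

/-- The conditions on the label of a basis vector `|μ)`, `m12 = μ_12`, `m22 = μ_22`,
`m11 = μ_11`. -/
def Admissible (p : ℕ) (m12 m22 m11 : ℤ) : Prop :=
  0 ≤ m22 ∧ 0 ≤ m12 ∧ m12 ≤ p ∧ (1 ≤ m22 → 1 ≤ m12) ∧
    (m12 - m11 = 0 ∨ m12 - m11 = 1) ∧ (m12 = 0 → m12 - m11 = 0)

/-- The labels `μ` of the basis vectors of `V(p)`. -/
structure GZLabel (p : ℕ) where
  m12 : ℤ
  m22 : ℤ
  m11 : ℤ
  adm : Admissible p m12 m22 m11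

/-- The label of the vacuum. -/
def vacLabel (p : ℕ) : GZLabel p := ⟨0, 0, 0, by simp [Admissible]⟩

/-- `θ = μ_12 - μ_11`, which is `0` or `1`. -/
def GZLabel.theta {p : ℕ} (μ : GZLabel p) : ℕ := (μ.m12 - μ.m11).toNat

open Classical in
/-- The vector with the given label; it is zero when the label is not admissible. -/
def ket {V : Type*} [Zero V] {p : ℕ} (e : GZLabel p → V) (m12 m22 m11 : ℤ) : V :=
  if h : Admissible p m12 m22 m11 then e ⟨m12, m22, m11, h⟩ else 0

/-- `1` on even integers, `0` on odd ones. -/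
def evenInd (j : ℤ) : ℝ := if Even j then 1 else 0

/-- `1` on odd integers, `0` on even ones. -/
def oddInd (j : ℤ) : ℝ := if Odd j then 1 else 0

/-- The reduced matrix element `G_1(a, b)`. At `a = b = 0` the factor `a` of the numerator cancels
against the denominator `a`, and the value is `√p`. -/
def G1 (p : ℕ) (a b : ℤ) : ℝ :=
  if a = 0 ∧ b = 0 then Real.sqrt p
  else Real.sqrt ((a * (a + b + 1) * (p - a)) / (a + b + 1 - oddInd (b + 1)))

/-- The reduced matrix element `G_2(a, b)`. -/
def G2 (p : ℕ) (a b : ℤ) : ℝ :=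
  Real.sqrt (((oddInd b * b + 1) * (evenInd (b + 1) * (p + b) + 1) *
      (oddInd (b + 1) * (a + b) + 1)) /
    (evenInd (b + 1) * (a + b - 1) + 1))

variable {p : ℕ} {V : Type*} [NormedAddCommGroup V] [InnerProductSpace ℂ V]

/-- The family `e μ = |μ)` is the Gel'fand-Zetlin basis of the parastatistics Fock space `F`:
an orthonormal (algebraic) basis that starts with the vacuum and on which the operators `c_j^±`
have the standard matrix elements. -/
structure IsGZBasis (F : ParaFockSpace p V) (e : GZLabel p → V) : Prop where
  orthonormal : Orthonormal ℂ e
  span_eq_top : Submodule.span ℂ (Set.range e) = ⊤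
  vac_eq : e (vacLabel p) = F.vac
  c1_plus : ∀ μ : GZLabel p, F.c 0 1 (e μ) =
    ((Real.sqrt ((μ.m12 + μ.m22) / (μ.m12 + μ.m22 + 1)) ^ μ.theta * G1 p μ.m12 μ.m22 : ℝ) : ℂ) •
        ket e (μ.m12 + 1) μ.m22 (μ.m11 + 1) -
    ((μ.theta * Real.sqrt (1 / (μ.m12 + μ.m22 + 1)) * G2 p μ.m12 μ.m22 : ℝ) : ℂ) •
        ket e μ.m12 (μ.m22 + 1) (μ.m11 + 1)
  c2_plus : ∀ μ : GZLabel p, F.c 1 1 (e μ) =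
    (((1 - μ.theta) * Real.sqrt (1 / (μ.m12 + μ.m22 + 1)) * G1 p μ.m12 μ.m22 : ℝ) : ℂ) •
        ket e (μ.m12 + 1) μ.m22 μ.m11 +
    (((-1) ^ μ.theta * Real.sqrt ((μ.m12 + μ.m22) / (μ.m11 + μ.m22 + 1)) *
        G2 p μ.m12 μ.m22 : ℝ) : ℂ) •
        ket e μ.m12 (μ.m22 + 1) μ.m11
  c1_minus : ∀ μ : GZLabel p, F.c 0 (-1) (e μ) =
    ((Real.sqrt ((μ.m12 + μ.m22 - 1) / (μ.m12 + μ.m22)) ^ μ.theta *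
        G1 p (μ.m12 - 1) μ.m22 : ℝ) : ℂ) •
        ket e (μ.m12 - 1) μ.m22 (μ.m11 - 1) -
    (((1 - μ.theta) * Real.sqrt (1 / (μ.m12 + μ.m22)) * G2 p μ.m12 (μ.m22 - 1) : ℝ) : ℂ) •
        ket e μ.m12 (μ.m22 - 1) (μ.m11 - 1)
  c2_minus : ∀ μ : GZLabel p, F.c 1 (-1) (e μ) =
    ((μ.theta * Real.sqrt (1 / (μ.m12 + μ.m22)) * G1 p (μ.m12 - 1) μ.m22 : ℝ) : ℂ) •
        ket e (μ.m12 - 1) μ.m22 μ.m11 +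
    (((-1) ^ μ.theta * Real.sqrt ((μ.m12 + μ.m22 - 1) / (μ.m11 + μ.m22)) *
        G2 p μ.m12 (μ.m22 - 1) : ℝ) : ℂ) •
        ket e μ.m12 (μ.m22 - 1) μ.m11

namespace ParaFockSpace

/-- The Cartan element `h_1`, given by `[c_1^-, c_1^+] = -2 h_1`. -/
def h1 (F : ParaFockSpace p V) : Module.End ℂ V :=
  (-1 / 2 : ℂ) • (F.c 0 (-1) * F.c 0 1 - F.c 0 1 * F.c 0 (-1))

/-- The angular momentum projection `M_1 = (c_1^+ + c_1^-) / 2`. -/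
def M1 (F : ParaFockSpace p V) : Module.End ℂ V :=
  (1 / 2 : ℂ) • (F.c 0 1 + F.c 0 (-1))

/-- The angular momentum projection `M_2 = -(i / 2) (c_1^+ - c_1^-)`. -/
def M2 (F : ParaFockSpace p V) : Module.End ℂ V :=
  (-Complex.I / 2) • (F.c 0 1 - F.c 0 (-1))

/-- The angular momentum projection `M_3 = [c_1^-, c_1^+] / 2`. -/
def M3 (F : ParaFockSpace p V) : Module.End ℂ V :=
  (1 / 2 : ℂ) • (F.c 0 (-1) * F.c 0 1 - F.c 0 1 * F.c 0 (-1))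

/-- The square `M² = M_1² + M_2² + M_3²` of the angular momentum. -/
def Msq (F : ParaFockSpace p V) : Module.End ℂ V :=
  F.M1 * F.M1 + F.M2 * F.M2 + F.M3 * F.M3

end ParaFockSpace

end Osp32

end

/-! The proof builds one Fock space explicitly and transports its basis to every other one, because
the relations and the vacuum conditions leave no freedom.

Uniqueness. The relations make the span of the creation words on the vacuum stable under all
`c_j^±`, so by irreducibility it is the whole space. For two spaces of the same order, let the
operators act diagonally on `V × V'` and take the cyclic subspace of the pair of vacua, `pairGraph`.
Adjointness moves a creation operator to the other side of an inner product as an annihilation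
operator, so inner products of words are determined by the algebra and agree in both components.
Hence `pairGraph` is the graph of an isometric bijection intertwining the operators, and it carries
a Gel'fand-Zetlin basis to such a basis (`exists_isGZBasis_of_isGZBasis`).

Existence. On a space with an algebraic orthonormal basis indexed by the labels, the operators are
defined by the matrix elements. Checking the triple relations with square roots would be
intractable, so the basis is rescaled (`fE0`, `fO0`, `fE1`, `fO1`, according to the parity of `μ_22`
and the value of `θ`) until all coefficients are rational. Ten identities are verified on the
rescaled vectors; together with their adjoints they give all the relations
(`GZAction.paraRelations`). Irreducibility holds because the annihilation operators lower the level
`μ_12 + μ_22`, only multiples of the vacuum are killed by both, and the vacuum is cyclic.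

Spectrum. The operator `[c_1^-, c_1^+]` is diagonal with eigenvalues `p - 2 μ_11`, and `0 ≤ μ_11 ≤
p`; this is the spectrum of `M_3`. Since `c_1^-` raises `M_3` by one and commutes with `M²`, the
usual highest weight argument bounds the total angular momentum by `p/2`, and the vacuum attains it.
-/

noncomputable section

namespace Osp32

/-! ### Cyclic subspaces generated by creation words -/

section Words

variable {U : Type*} [AddCommGroup U] [Module ℂ U]

/-- The vector obtained from `v` by a word in the creation operators. -/
def wordVec (c : Fin 2 → ℤˣ → Module.End ℂ U) (v : U) : List (Fin 2) → U
  | [] => v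
  | j :: w => c j 1 (wordVec c v w)

/-- The span of the vectors obtained from `v` by words in the creation operators. -/
def wordSpan (c : Fin 2 → ℤˣ → Module.End ℂ U) (v : U) : Submodule ℂ U :=
  Submodule.span ℂ (Set.range (wordVec c v))

theorem wordVec_mem (c : Fin 2 → ℤˣ → Module.End ℂ U) (v : U) (w : List (Fin 2)) :
    wordVec c v w ∈ wordSpan c v :=
  Submodule.subset_span ⟨w, rfl⟩

theorem map_mem_wordSpan {c : Fin 2 → ℤˣ → Module.End ℂ U} {v : U} {T : Module.End ℂ U}
    (h : ∀ w, T (wordVec c v w) ∈ wordSpan c v) {x : U} (hx : x ∈ wordSpan c v) :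
    T x ∈ wordSpan c v := by
  have : wordSpan c v ≤ (wordSpan c v).comap T := by
    refine Submodule.span_le.2 ?_
    rintro _ ⟨w, rfl⟩
    exact h w
  exact this hx

theorem plus_mem_wordSpan {c : Fin 2 → ℤˣ → Module.End ℂ U} {v : U} (j : Fin 2) {x : U}
    (hx : x ∈ wordSpan c v) : c j 1 x ∈ wordSpan c v :=
  map_mem_wordSpan (fun w => wordVec_mem c v (j :: w)) hx

/-- The bracket of `c_j^-` with `c_k^+` acts on the vacuum as a scalar, and moving it past a
creation operator costs only a multiple of a creation operator. Induction on the word length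
follows. -/
theorem bracket_wordVec_mem {c : Fin 2 → ℤˣ → Module.End ℂ U} {v : U} (hc : ParaRelations c)
    {q : ℂ} (hq : ∀ j k, superBracket (deg j) (deg k) (c j (-1)) (c k 1) v =
      (if j = k then q else 0) • v) (j k : Fin 2) (w : List (Fin 2)) :
    superBracket (deg j) (deg k) (c j (-1)) (c k 1) (wordVec c v w) ∈ wordSpan c v := by
  induction w with
  | nil =>
    rw [wordVec, hq]
    exact Submodule.smul_mem _ _ (wordVec_mem c v [])
  | cons l w ih =>
    have h := congrArg (fun T : Module.End ℂ U => T (wordVec c v w)) (hc j k l (-1) 1 1)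
    -- For the signs `(-, +, +)` only the first delta of the relation can survive, and it produces
    -- `c_k^+`.
    have h1 : ¬ (k = l ∧ (1 : ℤˣ) = -1) := by
      rintro ⟨-, h⟩
      exact absurd h (by decide)
    rw [if_neg h1, zero_smul, add_zero, superBracket] at h
    simp only [LinearMap.sub_apply, LinearMap.smul_apply, Module.End.mul_apply] at h
    rw [sub_eq_iff_eq_add] at h
    rw [wordVec, h]
    exact Submodule.add_mem _ (Submodule.smul_mem _ _ (plus_mem_wordSpan k (wordVec_mem c v w)))
      (Submodule.smul_mem _ _ (plus_mem_wordSpan l ih))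

theorem minus_wordVec_mem {c : Fin 2 → ℤˣ → Module.End ℂ U} {v : U} (hc : ParaRelations c)
    (h0 : ∀ j, c j (-1) v = 0)
    {q : ℂ} (hq : ∀ j k, superBracket (deg j) (deg k) (c j (-1)) (c k 1) v =
      (if j = k then q else 0) • v) (j : Fin 2) (w : List (Fin 2)) :
    c j (-1) (wordVec c v w) ∈ wordSpan c v := by
  induction w with
  | nil => rw [wordVec, h0]; exact Submodule.zero_mem _
  | cons k w ih =>
    have h : c j (-1) (wordVec c v (k :: w)) =
        superBracket (deg j) (deg k) (c j (-1)) (c k 1) (wordVec c v w) +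
          ((-1 : ℂ) ^ (deg j * deg k)) • c k 1 (c j (-1) (wordVec c v w)) := by
      simp [superBracket, wordVec]
    rw [h]
    exact Submodule.add_mem _ (bracket_wordVec_mem hc hq j k w)
      (Submodule.smul_mem _ _ (plus_mem_wordSpan k ih))

theorem op_mem_wordSpan {c : Fin 2 → ℤˣ → Module.End ℂ U} {v : U} (hc : ParaRelations c)
    (h0 : ∀ j, c j (-1) v = 0)
    {q : ℂ} (hq : ∀ j k, superBracket (deg j) (deg k) (c j (-1)) (c k 1) v =
      (if j = k then q else 0) • v) (j : Fin 2) (ξ : ℤˣ) {x : U} (hx : x ∈ wordSpan c v) :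
    c j ξ x ∈ wordSpan c v := by
  rcases Int.units_eq_one_or ξ with rfl | rfl
  · exact plus_mem_wordSpan j hx
  · exact map_mem_wordSpan (minus_wordVec_mem hc h0 hq j) hx

end Words

/-! ### Uniqueness of the Fock space and transport of the basis -/

section Uniqueness

variable {p : ℕ} {V V' : Type*} [NormedAddCommGroup V] [InnerProductSpace ℂ V]
  [NormedAddCommGroup V'] [InnerProductSpace ℂ V']

theorem ParaFockSpace.vac_ne_zero (F : ParaFockSpace p V) : F.vac ≠ 0 := by
  intro h
  have := F.vac_inner
  simp [h] at this

theorem ParaFockSpace.wordSpan_eq_top (F : ParaFockSpace p V) : wordSpan F.c F.vac = ⊤ := by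
  refine (F.irreducible _ fun j ξ x hx =>
    op_mem_wordSpan F.relations F.annihilate F.order j ξ hx).resolve_left fun h => ?_
  have : F.vac ∈ wordSpan F.c F.vac := wordVec_mem F.c F.vac []
  rw [h, Submodule.mem_bot] at this
  exact F.vac_ne_zero this

/-- The diagonal action on the product of two spaces. -/
def pairOp (F : ParaFockSpace p V) (F' : ParaFockSpace p V') (j : Fin 2) (ξ : ℤˣ) :
    Module.End ℂ (V × V') :=
  (F.c j ξ).prodMap (F'.c j ξ)

/-- The correspondence between two Fock spaces: the span of the pairs of vectors that are obtained
from the vacua by the same word. -/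
def pairGraph (F : ParaFockSpace p V) (F' : ParaFockSpace p V') : Submodule ℂ (V × V') :=
  wordSpan (pairOp F F') (F.vac, F'.vac)

variable (F : ParaFockSpace p V) (F' : ParaFockSpace p V')

theorem superBracket_prodMap (d e : ℕ) (A B : Module.End ℂ V) (A' B' : Module.End ℂ V') :
    superBracket d e (A.prodMap A') (B.prodMap B') =
      (superBracket d e A B).prodMap (superBracket d e A' B') := by
  refine LinearMap.ext fun x => ?_
  simp [superBracket]

theorem pairOp_relations : ParaRelations (pairOp F F') := by
  intro j k l ξ η ε
  simp only [pairOp, superBracket_prodMap, F.relations j k l ξ η ε, F'.relations j k l ξ η ε]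
  rfl

theorem op_mem_pairGraph (j : Fin 2) (ξ : ℤˣ) {x : V × V'} (hx : x ∈ pairGraph F F') :
    (F.c j ξ x.1, F'.c j ξ x.2) ∈ pairGraph F F' := by
  refine op_mem_wordSpan (q := p) (pairOp_relations F F') (fun j => ?_) (fun j k => ?_) j ξ hx
  · simp [pairOp, F.annihilate, F'.annihilate]
  · simp only [pairOp, superBracket_prodMap, LinearMap.prodMap_apply, F.order, F'.order]
    rfl

theorem wordVec_pairOp (w : List (Fin 2)) :
    wordVec (pairOp F F') (F.vac, F'.vac) w = (wordVec F.c F.vac w, wordVec F'.c F'.vac w) := by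
  induction w with
  | nil => rfl
  | cons j w ih => simp [wordVec, ih, pairOp]

/-- The leftmost creation operator of a nonempty word is adjoint to one that annihilates the vacuum.
The values do not depend on the space, which starts the comparison of inner products. -/
theorem inner_vac_wordVec (w : List (Fin 2)) :
    inner ℂ F.vac (wordVec F.c F.vac w) = if w = [] then (1 : ℂ) else 0 := by
  cases w with
  | nil => simp only [wordVec, F.vac_inner, if_true]
  | cons j w =>
    have h := F.adjoint j (-1) F.vac (wordVec F.c F.vac w)
    rw [F.annihilate, inner_zero_left, neg_neg] at h
    simp [wordVec, ← h]

/-- Peel the creation operators off a word on the left: each becomes an annihilation operator on the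
right, which preserves the graph. What remains is an inner product with the vacuum, equal on both
sides. -/
theorem inner_eq_of_mem_pairGraph {x y : V × V'} (hx : x ∈ pairGraph F F')
    (hy : y ∈ pairGraph F F') : (inner ℂ x.1 y.1 : ℂ) = inner ℂ x.2 y.2 := by
  have key : ∀ w : List (Fin 2), ∀ y ∈ pairGraph F F',
      (inner ℂ (wordVec F.c F.vac w) y.1 : ℂ) = inner ℂ (wordVec F'.c F'.vac w) y.2 := by
    intro w
    induction w with
    | nil =>
      intro y hy
      induction hy using Submodule.span_induction with
      | mem y h =>
        obtain ⟨w, rfl⟩ := h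
        simp only [wordVec_pairOp, wordVec, inner_vac_wordVec]
      | zero => simp
      | add a b _ _ ha hb => simp only [Prod.fst_add, Prod.snd_add, inner_add_right, ha, hb]
      | smul r a _ ha => simp only [Prod.smul_fst, Prod.smul_snd, inner_smul_right, ha]
    | cons j w ih =>
      intro y hy
      rw [wordVec, wordVec, F.adjoint, F'.adjoint]
      exact ih _ (op_mem_pairGraph F F' j (-1) hy)
  induction hx using Submodule.span_induction with
  | mem x h =>
    obtain ⟨w, rfl⟩ := h
    rw [wordVec_pairOp]
    exact key w y hy
  | zero => simp
  | add a b _ _ ha hb => simp only [Prod.fst_add, Prod.snd_add, inner_add_left, ha, hb]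
  | smul r a _ ha => simp only [Prod.smul_fst, Prod.smul_snd, inner_smul_left, ha]

/-- If `(0, d)` is in the graph, then `⟨d, d⟩ = ⟨0, 0⟩ = 0`. Thus identities in `V` pass to `V'`: it
suffices to exhibit both sides over the same first component. -/
theorem eq_of_mem_pairGraph {x : V} {y z : V'} (hy : (x, y) ∈ pairGraph F F')
    (hz : (x, z) ∈ pairGraph F F') : y = z := by
  have h : (0, y - z) ∈ pairGraph F F' := by
    simpa using Submodule.sub_mem _ hy hz
  have := inner_eq_of_mem_pairGraph F F' h h
  simp only [inner_zero_left] at this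
  exact sub_eq_zero.1 (inner_self_eq_zero.1 this.symm)

theorem exists_mem_pairGraph (x : V) : ∃ y, (x, y) ∈ pairGraph F F' := by
  have hx : x ∈ wordSpan F.c F.vac := by rw [F.wordSpan_eq_top]; trivial
  induction hx using Submodule.span_induction with
  | mem x h =>
    obtain ⟨w, rfl⟩ := h
    exact ⟨_, by rw [← wordVec_pairOp]; exact wordVec_mem _ _ w⟩
  | zero => exact ⟨0, Submodule.zero_mem _⟩
  | add a b _ _ ha hb =>
    obtain ⟨y, hy⟩ := ha
    obtain ⟨z, hz⟩ := hb
    exact ⟨y + z, Submodule.add_mem _ hy hz⟩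
  | smul r a _ ha =>
    obtain ⟨y, hy⟩ := ha
    exact ⟨r • y, Submodule.smul_mem _ r hy⟩

theorem exists_mem_pairGraph' (y : V') : ∃ x, (x, y) ∈ pairGraph F F' := by
  have hy : y ∈ wordSpan F'.c F'.vac := by rw [F'.wordSpan_eq_top]; trivial
  induction hy using Submodule.span_induction with
  | mem x h =>
    obtain ⟨w, rfl⟩ := h
    exact ⟨_, by rw [← wordVec_pairOp]; exact wordVec_mem _ _ w⟩
  | zero => exact ⟨0, Submodule.zero_mem _⟩
  | add a b _ _ ha hb =>
    obtain ⟨y, hy⟩ := ha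
    obtain ⟨z, hz⟩ := hb
    exact ⟨y + z, Submodule.add_mem _ hy hz⟩
  | smul r a _ ha =>
    obtain ⟨y, hy⟩ := ha
    exact ⟨r • y, Submodule.smul_mem _ r hy⟩

theorem ket_mem_pairGraph {e : GZLabel p → V} {e' : GZLabel p → V'}
    (h : ∀ μ, (e μ, e' μ) ∈ pairGraph F F') (a b m : ℤ) :
    (ket e a b m, ket e' a b m) ∈ pairGraph F F' := by
  unfold ket
  split_ifs
  · exact h _
  · exact Submodule.zero_mem _

/-- A Gel'fand-Zetlin basis of one Fock space of order `p` gives one of every other. -/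
theorem exists_isGZBasis_of_isGZBasis {e : GZLabel p → V} (he : IsGZBasis F e) :
    ∃ e' : GZLabel p → V', IsGZBasis F' e' := by
  choose e' h' using fun μ => exists_mem_pairGraph F F' (e μ)
  have hk := ket_mem_pairGraph F F' h'
  refine ⟨e', ?_, ?_, ?_, fun μ => ?_, fun μ => ?_, fun μ => ?_, fun μ => ?_⟩
  · have ho := he.orthonormal
    classical
    rw [orthonormal_iff_ite] at ho ⊢
    intro i j
    rw [← ho i j]
    exact (inner_eq_of_mem_pairGraph F F' (h' i) (h' j)).symm
  · refine Submodule.eq_top_iff'.2 fun y => ?_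
    obtain ⟨x, hx⟩ := exists_mem_pairGraph' F F' y
    have : ∀ x ∈ Submodule.span ℂ (Set.range e),
        ∃ y ∈ Submodule.span ℂ (Set.range e'), (x, y) ∈ pairGraph F F' := by
      intro x hx
      induction hx using Submodule.span_induction with
      | mem x h =>
        obtain ⟨μ, rfl⟩ := h
        exact ⟨e' μ, Submodule.subset_span ⟨μ, rfl⟩, h' μ⟩
      | zero => exact ⟨0, Submodule.zero_mem _, Submodule.zero_mem _⟩
      | add a b _ _ ha hb =>
        obtain ⟨y, hy, hy'⟩ := ha
        obtain ⟨z, hz, hz'⟩ := hb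
        exact ⟨y + z, Submodule.add_mem _ hy hz, Submodule.add_mem _ hy' hz'⟩
      | smul r a _ ha =>
        obtain ⟨y, hy, hy'⟩ := ha
        exact ⟨r • y, Submodule.smul_mem _ r hy, Submodule.smul_mem _ r hy'⟩
    obtain ⟨z, hz, hxz⟩ := this x (by rw [he.span_eq_top]; trivial)
    rwa [eq_of_mem_pairGraph F F' hx hxz]
  · refine eq_of_mem_pairGraph F F' (h' _) ?_
    rw [he.vac_eq]
    exact wordVec_mem (pairOp F F') (F.vac, F'.vac) []
  · refine eq_of_mem_pairGraph F F' (op_mem_pairGraph F F' 0 1 (h' μ)) ?_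
    rw [he.c1_plus μ]
    exact Submodule.sub_mem _ (Submodule.smul_mem _ _ (hk _ _ _)) (Submodule.smul_mem _ _ (hk _ _ _))
  · refine eq_of_mem_pairGraph F F' (op_mem_pairGraph F F' 1 1 (h' μ)) ?_
    rw [he.c2_plus μ]
    exact Submodule.add_mem _ (Submodule.smul_mem _ _ (hk _ _ _)) (Submodule.smul_mem _ _ (hk _ _ _))
  · refine eq_of_mem_pairGraph F F' (op_mem_pairGraph F F' 0 (-1) (h' μ)) ?_
    rw [he.c1_minus μ]
    exact Submodule.sub_mem _ (Submodule.smul_mem _ _ (hk _ _ _)) (Submodule.smul_mem _ _ (hk _ _ _))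
  · refine eq_of_mem_pairGraph F F' (op_mem_pairGraph F F' 1 (-1) (h' μ)) ?_
    rw [he.c2_minus μ]
    exact Submodule.add_mem _ (Submodule.smul_mem _ _ (hk _ _ _)) (Submodule.smul_mem _ _ (hk _ _ _))

end Uniqueness

/-! ### Reduced matrix elements by parity, and the rescaling weights -/

section Numbers

variable (p : ℕ)

theorem G1_even {a n : ℤ} (h : ¬ (a = 0 ∧ n = 0)) :
    G1 p a (2 * n) = √((a : ℝ) * (a + 2 * n + 1) * (p - a) / (a + 2 * n)) := by
  have h1 : ¬ (a = 0 ∧ 2 * n = 0) := by omega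
  have h2 : Odd (2 * n + 1) := ⟨n, rfl⟩
  simp only [G1, h1, if_false, oddInd, h2, if_true]
  push_cast
  ring_nf

theorem G1_odd {a n : ℤ} (h : 0 < a + 2 * n + 2) :
    G1 p a (2 * n + 1) = √((a : ℝ) * (p - a)) := by
  have h1 : ¬ (a = 0 ∧ 2 * n + 1 = 0) := by omega
  have h2 : ¬ Odd (2 * n + 1 + 1) := by
    rw [Int.not_odd_iff_even]
    exact ⟨n + 1, by ring⟩
  have h3 : (a : ℝ) + 2 * n + 2 ≠ 0 := by exact_mod_cast h.ne'
  simp only [G1, h1, if_false, oddInd, h2]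
  push_cast
  congr 1
  have h4 : (a : ℝ) + (2 * n + 1) + 1 = a + 2 * n + 2 := by ring
  rw [h4, sub_zero]
  field_simp

theorem G2_even (a n : ℤ) : G2 p a (2 * n) = √((a : ℝ) + 2 * n + 1) := by
  have h1 : ¬ Odd (2 * n) := by
    rw [Int.not_odd_iff_even]
    exact ⟨n, by ring⟩
  have h2 : Odd (2 * n + 1) := ⟨n, rfl⟩
  have h3 : ¬ Even (2 * n + 1) := by rwa [Int.not_even_iff_odd]
  simp only [G2, oddInd, evenInd, h1, h2, h3, if_true, if_false]
  push_cast
  congr 1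
  ring

theorem G2_odd (a n : ℤ) : G2 p a (2 * n + 1) =
    √((2 * n + 2 : ℝ) * (p + 2 * n + 2) / (a + 2 * n + 1)) := by
  have h1 : Odd (2 * n + 1) := ⟨n, rfl⟩
  have h2 : Even (2 * n + 1 + 1) := ⟨n + 1, by ring⟩
  have h3 : ¬ Odd (2 * n + 1 + 1) := by rwa [Int.not_odd_iff_even]
  simp only [G2, oddInd, evenInd, h1, h2, h3, if_true, if_false]
  push_cast
  congr 1
  ring

/-- The part of the squared norm that depends on `μ_12`. -/
def normA (a : ℤ) : ℝ := a * p.choose a.toNat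

/-- The part of the squared norm that depends on `μ_22`. -/
def normB (n : ℤ) : ℝ :=
  if n < 0 then 0 else ∏ i ∈ Finset.range n.toNat, ((p + 2 * i + 2 : ℝ) / (2 * i + 2))

/-- This is the recursion `normA (a + 1) / normA a = (p - a) / a`, freed of division so that it
holds at `a = 0`. The common factor is the binomial coefficient, by `(a + 1) * choose p (a + 1) = (p
- a) * choose p a`. -/
theorem normA_step {a : ℤ} (ha : 0 ≤ a) :
    ∃ C : ℝ, normA p a = a * C ∧ normA p (a + 1) = (p - a) * C := by
  lift a to ℕ using ha
  refine ⟨p.choose a, by simp [normA], ?_⟩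
  have h : ((a : ℤ) + 1).toNat = a + 1 := by omega
  rw [normA, h]
  push_cast
  rcases le_or_gt a p with hap | hap
  · have := Nat.choose_succ_right_eq p a
    have h' := congrArg (Nat.cast (R := ℝ)) this
    push_cast [Nat.cast_sub hap] at h'
    linarith
  · rw [Nat.choose_eq_zero_of_lt hap, Nat.choose_eq_zero_of_lt (by omega)]
    simp

/-- A division-free recursion again, so that `n = -1` is included, where `normB` jumps from `0` to
`1`. -/
theorem normB_step (hp : 1 ≤ p) {n : ℤ} (hn : -1 ≤ n) :
    ∃ D : ℝ, normB p n = (2 * n + 2) * D ∧ normB p (n + 1) = (p + 2 * n + 2) * D := by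
  have hp' : (1 : ℝ) ≤ p := by exact_mod_cast hp
  have hn' : (-1 : ℝ) ≤ n := by exact_mod_cast hn
  have h0 : (p : ℝ) + 2 * n + 2 ≠ 0 := by linarith
  refine ⟨normB p (n + 1) / (p + 2 * n + 2), ?_, by field_simp⟩
  rcases hn.eq_or_lt with rfl | hn
  · simp [normB]
  · lift n to ℕ using (by omega)
    have h : ((n : ℤ) + 1).toNat = n + 1 := by omega
    have h1 : ¬ (n : ℤ) < 0 := by omega
    have h2 : ¬ (n : ℤ) + 1 < 0 := by omega
    have h3 : (2 * n + 2 : ℝ) ≠ 0 := by positivity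
    simp only [normB, h, h1, h2, if_false, Finset.prod_range_succ, Int.toNat_natCast]
    push_cast at h0 ⊢
    field_simp

theorem normA_pos {a : ℤ} (h1 : 1 ≤ a) (h2 : a ≤ p) : 0 < normA p a := by
  have : 0 < p.choose a.toNat := Nat.choose_pos (by omega)
  have h3 : (0 : ℝ) < a := by exact_mod_cast h1
  have h4 : (0 : ℝ) < p.choose a.toNat := by exact_mod_cast this
  exact mul_pos h3 h4

theorem normB_pos {n : ℤ} (h : 0 ≤ n) : 0 < normB p n := by
  rw [normB, if_neg (by omega)]
  exact Finset.prod_pos fun i _ => by positivity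

theorem sqrt_mul_sqrt_eq {X N N' r : ℝ} (hX : 0 ≤ X) (hr : 0 ≤ r) (h : X * N = r ^ 2 * N') :
    √X * √N = r * √N' := by
  rw [← Real.sqrt_mul hX, h, Real.sqrt_mul (sq_nonneg r), Real.sqrt_sq hr]

end Numbers

/-! ### The matrix elements on kets with `θ = 0` and `θ = 1` -/

section Action

variable {V : Type*} [NormedAddCommGroup V] [InnerProductSpace ℂ V]

/-- The operators `c` act on the family `e` by the Gel'fand-Zetlin formulas. -/
structure GZAction (p : ℕ) (c : Fin 2 → ℤˣ → Module.End ℂ V) (e : GZLabel p → V) : Prop where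
  c1_plus : ∀ μ : GZLabel p, c 0 1 (e μ) =
    ((Real.sqrt ((μ.m12 + μ.m22) / (μ.m12 + μ.m22 + 1)) ^ μ.theta * G1 p μ.m12 μ.m22 : ℝ) : ℂ) •
        ket e (μ.m12 + 1) μ.m22 (μ.m11 + 1) -
    ((μ.theta * Real.sqrt (1 / (μ.m12 + μ.m22 + 1)) * G2 p μ.m12 μ.m22 : ℝ) : ℂ) •
        ket e μ.m12 (μ.m22 + 1) (μ.m11 + 1)
  c2_plus : ∀ μ : GZLabel p, c 1 1 (e μ) =
    (((1 - μ.theta) * Real.sqrt (1 / (μ.m12 + μ.m22 + 1)) * G1 p μ.m12 μ.m22 : ℝ) : ℂ) •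
        ket e (μ.m12 + 1) μ.m22 μ.m11 +
    (((-1) ^ μ.theta * Real.sqrt ((μ.m12 + μ.m22) / (μ.m11 + μ.m22 + 1)) *
        G2 p μ.m12 μ.m22 : ℝ) : ℂ) •
        ket e μ.m12 (μ.m22 + 1) μ.m11
  c1_minus : ∀ μ : GZLabel p, c 0 (-1) (e μ) =
    ((Real.sqrt ((μ.m12 + μ.m22 - 1) / (μ.m12 + μ.m22)) ^ μ.theta *
        G1 p (μ.m12 - 1) μ.m22 : ℝ) : ℂ) •
        ket e (μ.m12 - 1) μ.m22 (μ.m11 - 1) -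
    (((1 - μ.theta) * Real.sqrt (1 / (μ.m12 + μ.m22)) * G2 p μ.m12 (μ.m22 - 1) : ℝ) : ℂ) •
        ket e μ.m12 (μ.m22 - 1) (μ.m11 - 1)
  c2_minus : ∀ μ : GZLabel p, c 1 (-1) (e μ) =
    ((μ.theta * Real.sqrt (1 / (μ.m12 + μ.m22)) * G1 p (μ.m12 - 1) μ.m22 : ℝ) : ℂ) •
        ket e (μ.m12 - 1) μ.m22 μ.m11 +
    (((-1) ^ μ.theta * Real.sqrt ((μ.m12 + μ.m22 - 1) / (μ.m11 + μ.m22)) *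
        G2 p μ.m12 (μ.m22 - 1) : ℝ) : ℂ) •
        ket e μ.m12 (μ.m22 - 1) μ.m11

theorem IsGZBasis.gzAction {p : ℕ} {F : ParaFockSpace p V} {e : GZLabel p → V}
    (h : IsGZBasis F e) : GZAction p F.c e :=
  ⟨h.c1_plus, h.c2_plus, h.c1_minus, h.c2_minus⟩

variable {p : ℕ} {c : Fin 2 → ℤˣ → Module.End ℂ V} {e : GZLabel p → V}

omit [InnerProductSpace ℂ V] in
theorem ket_eq {a b m : ℤ} (h : Admissible p a b m) : ket e a b m = e ⟨a, b, m, h⟩ := dif_pos h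

omit [InnerProductSpace ℂ V] in
theorem ket_eq_zero {a b m : ℤ} (h : ¬ Admissible p a b m) : ket e a b m = 0 := dif_neg h

namespace GZAction

variable (H : GZAction p c e)
include H

theorem c1_plus_ket_zero {a b : ℤ} (h : Admissible p a b a) :
    c 0 1 (ket e a b a) = ((G1 p a b : ℝ) : ℂ) • ket e (a + 1) b (a + 1) := by
  rw [ket_eq h, H.c1_plus]
  simp [GZLabel.theta]

theorem c1_plus_ket_one {a b : ℤ} (h : Admissible p a b (a - 1)) :
    c 0 1 (ket e a b (a - 1)) =
      ((√((a + b : ℝ) / (a + b + 1)) * G1 p a b : ℝ) : ℂ) • ket e (a + 1) b (a + 1 - 1) -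
      ((√(1 / (a + b + 1 : ℝ)) * G2 p a b : ℝ) : ℂ) • ket e a (b + 1) a := by
  rw [ket_eq h, H.c1_plus]
  simp [GZLabel.theta]

theorem c2_plus_ket_zero {a b : ℤ} (h : Admissible p a b a) :
    c 1 1 (ket e a b a) =
      ((√(1 / (a + b + 1 : ℝ)) * G1 p a b : ℝ) : ℂ) • ket e (a + 1) b (a + 1 - 1) +
      ((√((a + b : ℝ) / (a + b + 1)) * G2 p a b : ℝ) : ℂ) • ket e a (b + 1) a := by
  rw [ket_eq h, H.c2_plus]
  simp [GZLabel.theta]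

theorem c2_plus_ket_one {a b : ℤ} (h : Admissible p a b (a - 1)) :
    c 1 1 (ket e a b (a - 1)) =
      -((√((a + b : ℝ) / (a + b)) * G2 p a b : ℝ) : ℂ) • ket e a (b + 1) (a - 1) := by
  rw [ket_eq h, H.c2_plus]
  have : (a : ℝ) - 1 + b + 1 = a + b := by ring
  simp [GZLabel.theta, this]

theorem c1_minus_ket_zero {a b : ℤ} (h : Admissible p a b a) :
    c 0 (-1) (ket e a b a) =
      ((G1 p (a - 1) b : ℝ) : ℂ) • ket e (a - 1) b (a - 1) -
      ((√(1 / (a + b : ℝ)) * G2 p a (b - 1) : ℝ) : ℂ) • ket e a (b - 1) (a - 1) := by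
  rw [ket_eq h, H.c1_minus]
  simp [GZLabel.theta]

theorem c1_minus_ket_one {a b : ℤ} (h : Admissible p a b (a - 1)) :
    c 0 (-1) (ket e a b (a - 1)) =
      ((√((a + b - 1 : ℝ) / (a + b)) * G1 p (a - 1) b : ℝ) : ℂ) •
        ket e (a - 1) b (a - 1 - 1) := by
  rw [ket_eq h, H.c1_minus]
  simp [GZLabel.theta]

theorem c2_minus_ket_zero {a b : ℤ} (h : Admissible p a b a) :
    c 1 (-1) (ket e a b a) =
      ((√((a + b - 1 : ℝ) / (a + b)) * G2 p a (b - 1) : ℝ) : ℂ) • ket e a (b - 1) a := by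
  rw [ket_eq h, H.c2_minus]
  simp [GZLabel.theta]

theorem c2_minus_ket_one {a b : ℤ} (h : Admissible p a b (a - 1)) :
    c 1 (-1) (ket e a b (a - 1)) =
      ((√(1 / (a + b : ℝ)) * G1 p (a - 1) b : ℝ) : ℂ) • ket e (a - 1) b (a - 1) -
      ((√((a + b - 1 : ℝ) / (a + b - 1)) * G2 p a (b - 1) : ℝ) : ℂ) •
        ket e a (b - 1) (a - 1) := by
  rw [ket_eq h, H.c2_minus]
  have : (a : ℝ) + -1 + b = a + b + -1 := by ring
  simp [GZLabel.theta, this, sub_eq_add_neg]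

end GZAction

end Action

/-! ### Rescaled vectors, on which the operators have rational coefficients -/

section Rescaled

variable {V : Type*} [NormedAddCommGroup V] [InnerProductSpace ℂ V] {p : ℕ}

/-- The rescaled basis vector with `μ_22 = 2 n` and `θ = 0`. -/
def fE0 (e : GZLabel p → V) (a n : ℤ) : V :=
  ((√(normA p a * normB p n * (a + 2 * n)) : ℝ) : ℂ) • ket e a (2 * n) a

/-- The rescaled basis vector with `μ_22 = 2 n + 1` and `θ = 0`. -/
def fO0 (e : GZLabel p → V) (a n : ℤ) : V :=
  ((√(normA p a * normB p n) : ℝ) : ℂ) • ket e a (2 * n + 1) a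

/-- The rescaled basis vector with `μ_22 = 2 n` and `θ = 1`. -/
def fE1 (e : GZLabel p → V) (a n : ℤ) : V :=
  ((√(normA p a * normB p n) : ℝ) : ℂ) • ket e a (2 * n) (a - 1)

/-- The rescaled basis vector with `μ_22 = 2 n + 1` and `θ = 1`. -/
def fO1 (e : GZLabel p → V) (a n : ℤ) : V :=
  ((√(normA p a * normB p n / (a + 2 * n + 1)) : ℝ) : ℂ) • ket e a (2 * n + 1) (a - 1)

variable {c : Fin 2 → ℤˣ → Module.End ℂ V} {e : GZLabel p → V} {a n : ℤ}

/-- Outside the range the ket vanishes, except that at `a = 0` the weight `normA` vanishes instead.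
So the vacuum is not among the rescaled vectors and has to be treated apart. -/
theorem fE0_eq_zero (h : ¬ (1 ≤ a ∧ a ≤ p ∧ 0 ≤ n)) : fE0 e a n = 0 := by
  rcases eq_or_ne a 0 with rfl | ha
  · simp [fE0, normA]
  · rw [fE0, ket_eq_zero, smul_zero]
    rintro ⟨h1, h2, h3, h4, h5, h6⟩
    omega

theorem fO0_eq_zero (h : ¬ (1 ≤ a ∧ a ≤ p ∧ 0 ≤ n)) : fO0 e a n = 0 := by
  rcases eq_or_ne a 0 with rfl | ha
  · simp [fO0, normA]
  · rw [fO0, ket_eq_zero, smul_zero]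
    rintro ⟨h1, h2, h3, h4, h5, h6⟩
    omega

theorem fE1_eq_zero (h : ¬ (1 ≤ a ∧ a ≤ p ∧ 0 ≤ n)) : fE1 e a n = 0 := by
  rcases eq_or_ne a 0 with rfl | ha
  · simp [fE1, normA]
  · rw [fE1, ket_eq_zero, smul_zero]
    rintro ⟨h1, h2, h3, h4, h5, h6⟩
    omega

theorem fO1_eq_zero (h : ¬ (1 ≤ a ∧ a ≤ p ∧ 0 ≤ n)) : fO1 e a n = 0 := by
  rcases eq_or_ne a 0 with rfl | ha
  · simp [fO1, normA]
  · rw [fO1, ket_eq_zero, smul_zero]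
    rintro ⟨h1, h2, h3, h4, h5, h6⟩
    omega

/-- Here `√X` is a matrix element, `√N` and `√N'` are the weights of source and target, and `r` is
the rational coefficient. Comparing squares leaves an identity of rational functions. -/
theorem smul_sqrt_smul {X N N' r' : ℝ} {r : ℂ} {v : V} (hr : r = r') (hX : 0 ≤ X) (h0 : 0 ≤ r')
    (h : X * N = r' ^ 2 * N') : ((√N : ℝ) : ℂ) • ((√X : ℝ) : ℂ) • v = r • ((√N' : ℝ) : ℂ) • v := by
  rw [smul_smul, smul_smul, hr, ← Complex.ofReal_mul, ← Complex.ofReal_mul,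
    ← sqrt_mul_sqrt_eq hX h0 h, mul_comm]

theorem smul_sqrt_mul_sqrt_smul {X Y N N' r' : ℝ} {r : ℂ} {v : V} (hr : r = r') (hX : 0 ≤ X)
    (hY : 0 ≤ Y) (h0 : 0 ≤ r') (h : X * Y * N = r' ^ 2 * N') :
    ((√N : ℝ) : ℂ) • ((√X * √Y : ℝ) : ℂ) • v = r • ((√N' : ℝ) : ℂ) • v := by
  rw [← Real.sqrt_mul hX]
  exact smul_sqrt_smul hr (mul_nonneg hX hY) h0 h

theorem label_bounds (h : 1 ≤ a ∧ a ≤ p ∧ 0 ≤ n) : (0 : ℝ) < a ∧ (0 : ℝ) ≤ a - 1 ∧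
    (0 : ℝ) ≤ p - a ∧ (0 : ℝ) ≤ p - (a - 1) ∧ (0 : ℝ) ≤ n ∧
    (0 : ℝ) < a + (2 * n + 1) - 1 ∧ (0 : ℝ) ≤ 2 * (n - 1) + 2 ∧ (0 : ℝ) ≤ p + 2 * (n - 1) + 2 := by
  obtain ⟨h1, h2, h3⟩ := h
  have h1' : (1 : ℝ) ≤ a := by exact_mod_cast h1
  have h2' : (a : ℝ) ≤ p := by exact_mod_cast h2
  have h3' : (0 : ℝ) ≤ n := by exact_mod_cast h3
  refine ⟨?_, ?_, ?_, ?_, ?_, ?_, ?_, ?_⟩ <;> linarith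

theorem level_bounds (ha : 1 ≤ a) (hn : 0 ≤ n) (h10 : ¬ (a = 1 ∧ n = 0)) :
    (0 : ℝ) < a - 1 + 2 * n ∧ (0 : ℝ) < a + 2 * n - 1 ∧ (0 : ℝ) < a + 2 * (n - 1) + 1 := by
  have : 0 < a - 1 + 2 * n := by omega
  have : (0 : ℝ) < a - 1 + 2 * n := by exact_mod_cast this
  refine ⟨this, ?_, ?_⟩ <;> linarith

theorem admissible_zero {b : ℤ} (ha : 1 ≤ a) (hp : a ≤ p) (hb : 0 ≤ b) : Admissible p a b a := by
  refine ⟨hb, ?_, hp, ?_, ?_, ?_⟩ <;> omega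

theorem admissible_one {b : ℤ} (ha : 1 ≤ a) (hp : a ≤ p) (hb : 0 ≤ b) :
    Admissible p a b (a - 1) := by
  refine ⟨hb, ?_, hp, ?_, ?_, ?_⟩ <;> omega

namespace GZAction

variable (H : GZAction p c e)
include H

/-- Inside the range the weights are chosen so that the square roots cancel; at `a = p` the target
is zero. Outside the range both sides vanish, so the formula can be iterated without checking the
bound `a ≤ p`. -/
theorem c1_plus_fE0 (ha : 0 ≤ a) :
    c 0 1 (fE0 e a n) =
      (a : ℂ) • fE0 e (a + 1) n := by
  by_cases h : 1 ≤ a ∧ a ≤ p ∧ 0 ≤ n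
  · obtain ⟨ha0, ha1, hpa, hpa1, hn0, hl, hb, hpb⟩ := label_bounds h
    obtain ⟨C, hC, hC1⟩ := normA_step p ha
    rw [fE0, map_smul, H.c1_plus_ket_zero (admissible_zero h.1 h.2.1 (by omega))]
    rw [fE0, G1_even p (by omega)]
    refine smul_sqrt_smul (r' := a) (by push_cast; rfl)
      (by positivity) (by positivity) ?_
    rw [hC, hC1]; push_cast; field_simp; ring
  · rw [fE0_eq_zero h, map_zero]
    rcases eq_or_ne a 0 with rfl | ha'
    · simp
    · simp (disch := omega) [fE0_eq_zero]

theorem c1_plus_fO0 (ha : 0 ≤ a) :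
    c 0 1 (fO0 e a n) =
      (a : ℂ) • fO0 e (a + 1) n := by
  by_cases h : 1 ≤ a ∧ a ≤ p ∧ 0 ≤ n
  · obtain ⟨ha0, ha1, hpa, hpa1, hn0, hl, hb, hpb⟩ := label_bounds h
    obtain ⟨C, hC, hC1⟩ := normA_step p ha
    rw [fO0, map_smul, H.c1_plus_ket_zero (admissible_zero h.1 h.2.1 (by omega))]
    rw [fO0, G1_odd p (by omega)]
    refine smul_sqrt_smul (r' := a) (by push_cast; rfl)
      (by positivity) (by positivity) ?_
    rw [hC, hC1]; field_simp
  · rw [fO0_eq_zero h, map_zero]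
    rcases eq_or_ne a 0 with rfl | ha'
    · simp
    · simp (disch := omega) [fO0_eq_zero]

theorem c1_plus_fE1 (ha : 0 ≤ a) :
    c 0 1 (fE1 e a n) =
      (a : ℂ) • fE1 e (a + 1) n - (1 : ℂ) • fO0 e a n := by
  by_cases h : 1 ≤ a ∧ a ≤ p ∧ 0 ≤ n
  · obtain ⟨ha0, ha1, hpa, hpa1, hn0, hl, hb, hpb⟩ := label_bounds h
    obtain ⟨C, hC, hC1⟩ := normA_step p ha
    rw [fE1, map_smul, H.c1_plus_ket_one (admissible_one h.1 h.2.1 (by omega))]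
    rw [smul_sub]
    congr 1
    · rw [fE1, G1_even p (by omega)]
      refine smul_sqrt_mul_sqrt_smul (r' := a) (by push_cast; rfl)
        (by push_cast; positivity) (by positivity) (by positivity) ?_
      rw [hC, hC1]; push_cast; field_simp
    · rw [fO0, G2_even p]
      refine smul_sqrt_mul_sqrt_smul (r' := 1) (by push_cast; rfl)
        (by push_cast; positivity) (by positivity) (by positivity) ?_
      push_cast; field_simp
  · rw [fE1_eq_zero h, map_zero]
    rcases eq_or_ne a 0 with rfl | ha'
    · simp (disch := omega) [fO0_eq_zero]
    · simp (disch := omega) [fE1_eq_zero, fO0_eq_zero]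

theorem c1_plus_fO1 (hn : -1 ≤ n) (ha : 0 ≤ a) :
    c 0 1 (fO1 e a n) =
      (a : ℂ) • fO1 e (a + 1) n -
        ((2 * n + 2) / (a + 2 * n + 1) / (a + 2 * n + 2) : ℂ) • fE0 e a (n + 1) := by
  by_cases h : 1 ≤ a ∧ a ≤ p ∧ 0 ≤ n
  · obtain ⟨ha0, ha1, hpa, hpa1, hn0, hl, hb, hpb⟩ := label_bounds h
    obtain ⟨C, hC, hC1⟩ := normA_step p ha
    obtain ⟨D, hD, hD1⟩ := normB_step p (by omega) hn
    rw [fO1, map_smul, H.c1_plus_ket_one (admissible_one h.1 h.2.1 (by omega))]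
    rw [smul_sub]
    congr 1
    · rw [fO1, G1_odd p (by omega)]
      refine smul_sqrt_mul_sqrt_smul (r' := a) (by push_cast; rfl)
        (by push_cast; positivity) (by positivity) (by positivity) ?_
      rw [hC, hC1]; push_cast; field_simp; ring
    · rw [show (2 * n + 1 + 1 : ℤ) = 2 * (n + 1) by ring]
      rw [fE0, G2_odd p]
      refine smul_sqrt_mul_sqrt_smul (r' := (2 * n + 2) / (a + 2 * n + 1) / (a + 2 * n + 2))
        (by push_cast; rfl)
        (by push_cast; positivity) (by positivity) (by positivity) ?_
      rw [hD, hD1]; push_cast; field_simp; ring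
  · rw [fO1_eq_zero h, map_zero]
    rcases eq_or_ne a 0 with rfl | ha'
    · simp (disch := omega) [fE0_eq_zero]
    -- At `n = -1` the target `fE0 e a 0` need not vanish, but its coefficient `2 n + 2` does.
    rcases hn.eq_or_lt with rfl | hn'
    · simp (disch := omega) [fO1_eq_zero]
    · simp (disch := omega) [fO1_eq_zero, fE0_eq_zero]

theorem c2_plus_fE0 (ha : 0 ≤ a) :
    c 1 1 (fE0 e a n) =
      (a : ℂ) • fE1 e (a + 1) n + (a + 2 * n : ℂ) • fO0 e a n := by
  by_cases h : 1 ≤ a ∧ a ≤ p ∧ 0 ≤ n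
  · obtain ⟨ha0, ha1, hpa, hpa1, hn0, hl, hb, hpb⟩ := label_bounds h
    obtain ⟨C, hC, hC1⟩ := normA_step p ha
    rw [fE0, map_smul, H.c2_plus_ket_zero (admissible_zero h.1 h.2.1 (by omega))]
    rw [smul_add]
    congr 1
    · rw [fE1, G1_even p (by omega)]
      refine smul_sqrt_mul_sqrt_smul (r' := a) (by push_cast; rfl)
        (by push_cast; positivity) (by positivity) (by positivity) ?_
      rw [hC, hC1]; push_cast; field_simp
    · rw [fO0, G2_even p]
      refine smul_sqrt_mul_sqrt_smul (r' := a + 2 * n) (by push_cast; rfl)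
        (by push_cast; positivity) (by positivity) (by positivity) ?_
      push_cast; field_simp
  · rw [fE0_eq_zero h, map_zero]
    rcases eq_or_ne a 0 with rfl | ha'
    · simp (disch := omega) [fO0_eq_zero]
    · simp (disch := omega) [fE1_eq_zero, fO0_eq_zero]

theorem c2_plus_fO0 (hn : -1 ≤ n) (ha : 0 ≤ a) :
    c 1 1 (fO0 e a n) =
      (a : ℂ) • fO1 e (a + 1) n + ((2 * n + 2) / (a + 2 * n + 2) : ℂ) • fE0 e a (n + 1) := by
  by_cases h : 1 ≤ a ∧ a ≤ p ∧ 0 ≤ n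
  · obtain ⟨ha0, ha1, hpa, hpa1, hn0, hl, hb, hpb⟩ := label_bounds h
    obtain ⟨C, hC, hC1⟩ := normA_step p ha
    obtain ⟨D, hD, hD1⟩ := normB_step p (by omega) hn
    rw [fO0, map_smul, H.c2_plus_ket_zero (admissible_zero h.1 h.2.1 (by omega))]
    rw [smul_add]
    congr 1
    · rw [fO1, G1_odd p (by omega)]
      refine smul_sqrt_mul_sqrt_smul (r' := a) (by push_cast; rfl)
        (by push_cast; positivity) (by positivity) (by positivity) ?_
      rw [hC, hC1]; push_cast; field_simp; ring
    · rw [show (2 * n + 1 + 1 : ℤ) = 2 * (n + 1) by ring]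
      rw [fE0, G2_odd p]
      refine smul_sqrt_mul_sqrt_smul (r' := (2 * n + 2) / (a + 2 * n + 2)) (by push_cast; rfl)
        (by push_cast; positivity) (by positivity) (by positivity) ?_
      rw [hD, hD1]; push_cast; field_simp; ring
  · rw [fO0_eq_zero h, map_zero]
    rcases eq_or_ne a 0 with rfl | ha'
    · simp (disch := omega) [fE0_eq_zero]
    rcases hn.eq_or_lt with rfl | hn'
    · simp (disch := omega) [fO1_eq_zero]
    · simp (disch := omega) [fO1_eq_zero, fE0_eq_zero]

theorem c2_plus_fE1 (ha : 0 ≤ a) :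
    c 1 1 (fE1 e a n) =
      -((a + 2 * n + 1 : ℂ) • fO1 e a n) := by
  by_cases h : 1 ≤ a ∧ a ≤ p ∧ 0 ≤ n
  · obtain ⟨ha0, ha1, hpa, hpa1, hn0, hl, hb, hpb⟩ := label_bounds h
    rw [fE1, map_smul, H.c2_plus_ket_one (admissible_one h.1 h.2.1 (by omega))]
    rw [neg_smul, smul_neg]
    congr 1
    rw [fO1, G2_even p]
    refine smul_sqrt_mul_sqrt_smul (r' := a + 2 * n + 1) (by push_cast; rfl)
      (by push_cast; positivity) (by positivity) (by positivity) ?_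
    push_cast; field_simp
  · rw [fE1_eq_zero h, map_zero]
    rcases eq_or_ne a 0 with rfl | ha'
    · simp (disch := omega) [fO1_eq_zero]
    · simp (disch := omega) [fO1_eq_zero]

theorem c2_plus_fO1 (hn : -1 ≤ n) (ha : 0 ≤ a) :
    c 1 1 (fO1 e a n) =
      -(((2 * n + 2) / (a + 2 * n + 1) : ℂ) • fE1 e a (n + 1)) := by
  by_cases h : 1 ≤ a ∧ a ≤ p ∧ 0 ≤ n
  · obtain ⟨ha0, ha1, hpa, hpa1, hn0, hl, hb, hpb⟩ := label_bounds h
    obtain ⟨D, hD, hD1⟩ := normB_step p (by omega) hn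
    rw [fO1, map_smul, H.c2_plus_ket_one (admissible_one h.1 h.2.1 (by omega))]
    rw [neg_smul, smul_neg]
    congr 1
    rw [show (2 * n + 1 + 1 : ℤ) = 2 * (n + 1) by ring]
    rw [fE1, G2_odd p]
    refine smul_sqrt_mul_sqrt_smul (r' := (2 * n + 2) / (a + 2 * n + 1)) (by push_cast; rfl)
      (by push_cast; positivity) (by positivity) (by positivity) ?_
    rw [hD, hD1]; push_cast; field_simp
  · rw [fO1_eq_zero h, map_zero]
    rcases eq_or_ne a 0 with rfl | ha'
    · simp (disch := omega) [fE1_eq_zero]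
    rcases hn.eq_or_lt with rfl | hn'
    · simp []
    · simp (disch := omega) [fE1_eq_zero]

/-- The pair `(1, 0)` is excluded because the image is then a multiple of the vacuum, which is not a
rescaled vector; there the denominator `a - 1 + 2 n` is zero. -/
theorem c1_minus_fE0 (ha : 1 ≤ a) (h10 : ¬ (a = 1 ∧ n = 0)) :
    c 0 (-1) (fE0 e a n) =
      ((a + 2 * n) / (a - 1 + 2 * n) * (p -
        (a - 1)) : ℂ) • fE0 e (a - 1) n - (p + 2 * n : ℂ) • fO1 e a (n - 1) := by
  by_cases h : 1 ≤ a ∧ a ≤ p ∧ 0 ≤ n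
  · obtain ⟨ha0, ha1, hpa, hpa1, hn0, hl, hb, hpb⟩ := label_bounds h
    obtain ⟨hl1, hl2, hl3⟩ := level_bounds ha h.2.2 h10
    obtain ⟨C, hC, hC1⟩ := normA_step p (a := a - 1) (by omega)
    rw [sub_add_cancel] at hC1
    obtain ⟨D, hD, hD1⟩ := normB_step p (n := n - 1) (by omega) (by omega)
    rw [sub_add_cancel] at hD1
    rw [fE0, map_smul, H.c1_minus_ket_zero (admissible_zero h.1 h.2.1 (by omega))]
    rw [smul_sub]
    congr 1
    · rw [fE0, G1_even p (by omega)]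
      refine smul_sqrt_smul (r' := (a + 2 * n) / (a - 1 + 2 * n) * (p - (a - 1)))
        (by push_cast; rfl)
        (by push_cast; positivity) (by positivity) ?_
      rw [hC, hC1]; push_cast; field_simp; ring
    · rw [show (2 * n - 1 : ℤ) = 2 * (n - 1) + 1 by ring]
      rw [fO1, G2_odd p]
      refine smul_sqrt_mul_sqrt_smul (r' := p + 2 * n) (by push_cast; rfl)
        (by push_cast; positivity) (by push_cast; positivity) (by positivity) ?_
      rw [hD, hD1]; push_cast; field_simp; ring
  · rw [fE0_eq_zero h, map_zero]
    -- At `a = p + 1` the source is zero while the target with `a - 1 = p` need not be; the factor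
    -- `p - (a - 1)` removes it.
    rcases eq_or_ne a (p + 1) with rfl | ha'
    · simp (disch := omega) [fO1_eq_zero]
    · simp (disch := omega) [fE0_eq_zero, fO1_eq_zero]

theorem c1_minus_fO0 (ha : 1 ≤ a) :
    c 0 (-1) (fO0 e a n) =
      (p - (a - 1) : ℂ) • fO0 e (a - 1) n - (1 : ℂ) • fE1 e a n := by
  by_cases h : 1 ≤ a ∧ a ≤ p ∧ 0 ≤ n
  · obtain ⟨ha0, ha1, hpa, hpa1, hn0, hl, hb, hpb⟩ := label_bounds h
    obtain ⟨C, hC, hC1⟩ := normA_step p (a := a - 1) (by omega)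
    rw [sub_add_cancel] at hC1
    rw [fO0, map_smul, H.c1_minus_ket_zero (admissible_zero h.1 h.2.1 (by omega))]
    rw [smul_sub]
    congr 1
    · rw [fO0, G1_odd p (by omega)]
      refine smul_sqrt_smul (r' := p - (a - 1)) (by push_cast; rfl)
        (by push_cast; positivity) (by positivity) ?_
      rw [hC, hC1]; push_cast; field_simp
    · rw [add_sub_cancel_right]
      rw [fE1, G2_even p]
      refine smul_sqrt_mul_sqrt_smul (r' := 1) (by push_cast; rfl)
        (by push_cast; positivity) (by positivity) (by positivity) ?_
      push_cast; field_simp; ring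
  · rw [fO0_eq_zero h, map_zero]
    rcases eq_or_ne a (p + 1) with rfl | ha'
    · simp (disch := omega) [fE1_eq_zero]
    · simp (disch := omega) [fO0_eq_zero, fE1_eq_zero]

theorem c1_minus_fE1 (ha : 1 ≤ a) (h10 : ¬ (a = 1 ∧ n = 0)) :
    c 0 (-1) (fE1 e a n) =
      (p - (a - 1) : ℂ) • fE1 e (a - 1) n := by
  by_cases h : 1 ≤ a ∧ a ≤ p ∧ 0 ≤ n
  · obtain ⟨ha0, ha1, hpa, hpa1, hn0, hl, hb, hpb⟩ := label_bounds h
    obtain ⟨hl1, hl2, hl3⟩ := level_bounds ha h.2.2 h10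
    obtain ⟨C, hC, hC1⟩ := normA_step p (a := a - 1) (by omega)
    rw [sub_add_cancel] at hC1
    rw [fE1, map_smul, H.c1_minus_ket_one (admissible_one h.1 h.2.1 (by omega))]
    rw [fE1, G1_even p (by omega)]
    refine smul_sqrt_mul_sqrt_smul (r' := p - (a - 1)) (by push_cast; rfl)
      (by push_cast; positivity) (by push_cast; positivity) (by positivity) ?_
    rw [hC, hC1]; push_cast; field_simp; ring
  · rw [fE1_eq_zero h, map_zero]
    rcases eq_or_ne a (p + 1) with rfl | ha'
    · simp
    · simp (disch := omega) [fE1_eq_zero]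

theorem c1_minus_fO1 (ha : 1 ≤ a) :
    c 0 (-1) (fO1 e a n) =
      ((a + 2 * n) / (a + 2 * n + 1) * (p - (a - 1)) : ℂ) • fO1 e (a - 1) n := by
  by_cases h : 1 ≤ a ∧ a ≤ p ∧ 0 ≤ n
  · obtain ⟨ha0, ha1, hpa, hpa1, hn0, hl, hb, hpb⟩ := label_bounds h
    obtain ⟨C, hC, hC1⟩ := normA_step p (a := a - 1) (by omega)
    rw [sub_add_cancel] at hC1
    rw [fO1, map_smul, H.c1_minus_ket_one (admissible_one h.1 h.2.1 (by omega))]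
    rw [fO1, G1_odd p (by omega)]
    refine smul_sqrt_mul_sqrt_smul (r' := (a + 2 * n) / (a + 2 * n + 1) * (p - (a - 1)))
      (by push_cast; rfl)
      (by push_cast; positivity) (by push_cast; positivity) (by positivity) ?_
    rw [hC, hC1]; push_cast; field_simp; ring
  · rw [fO1_eq_zero h, map_zero]
    rcases eq_or_ne a (p + 1) with rfl | ha'
    · simp
    · simp (disch := omega) [fO1_eq_zero]

theorem c2_minus_fE0 (ha : 1 ≤ a) (h10 : ¬ (a = 1 ∧ n = 0)) :
    c 1 (-1) (fE0 e a n) =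
      (p + 2 * n : ℂ) • fO0 e a (n - 1) := by
  by_cases h : 1 ≤ a ∧ a ≤ p ∧ 0 ≤ n
  · obtain ⟨ha0, ha1, hpa, hpa1, hn0, hl, hb, hpb⟩ := label_bounds h
    obtain ⟨hl1, hl2, hl3⟩ := level_bounds ha h.2.2 h10
    obtain ⟨D, hD, hD1⟩ := normB_step p (n := n - 1) (by omega) (by omega)
    rw [sub_add_cancel] at hD1
    rw [fE0, map_smul, H.c2_minus_ket_zero (admissible_zero h.1 h.2.1 (by omega))]
    rw [show (2 * n - 1 : ℤ) = 2 * (n - 1) + 1 by ring]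
    rw [fO0, G2_odd p]
    refine smul_sqrt_mul_sqrt_smul (r' := p + 2 * n) (by push_cast; rfl)
      (by push_cast; positivity) (by push_cast; positivity) (by positivity) ?_
    rw [hD, hD1]; push_cast; field_simp; ring
  · rw [fE0_eq_zero h, map_zero]
    simp (disch := omega) [fO0_eq_zero]

theorem c2_minus_fO0 (ha : 1 ≤ a) :
    c 1 (-1) (fO0 e a n) =
      (1 : ℂ) • fE0 e a n := by
  by_cases h : 1 ≤ a ∧ a ≤ p ∧ 0 ≤ n
  · obtain ⟨ha0, ha1, hpa, hpa1, hn0, hl, hb, hpb⟩ := label_bounds h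
    rw [fO0, map_smul, H.c2_minus_ket_zero (admissible_zero h.1 h.2.1 (by omega))]
    rw [add_sub_cancel_right]
    rw [fE0, G2_even p]
    refine smul_sqrt_mul_sqrt_smul (r' := 1) (by push_cast; rfl)
      (by push_cast; positivity) (by positivity) (by positivity) ?_
    push_cast; field_simp; ring
  · rw [fO0_eq_zero h, map_zero]
    simp (disch := omega) [fE0_eq_zero]

theorem c2_minus_fE1 (ha : 1 ≤ a) (h10 : ¬ (a = 1 ∧ n = 0)) :
    c 1 (-1) (fE1 e a n) =
      ((p -
        (a - 1)) / (a - 1 + 2 * n) : ℂ) • fE0 e (a - 1) n - (p + 2 * n : ℂ) • fO1 e a (n - 1) := by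
  by_cases h : 1 ≤ a ∧ a ≤ p ∧ 0 ≤ n
  · obtain ⟨ha0, ha1, hpa, hpa1, hn0, hl, hb, hpb⟩ := label_bounds h
    obtain ⟨hl1, hl2, hl3⟩ := level_bounds ha h.2.2 h10
    obtain ⟨C, hC, hC1⟩ := normA_step p (a := a - 1) (by omega)
    rw [sub_add_cancel] at hC1
    obtain ⟨D, hD, hD1⟩ := normB_step p (n := n - 1) (by omega) (by omega)
    rw [sub_add_cancel] at hD1
    rw [fE1, map_smul, H.c2_minus_ket_one (admissible_one h.1 h.2.1 (by omega))]
    rw [smul_sub]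
    congr 1
    · rw [fE0, G1_even p (by omega)]
      refine smul_sqrt_mul_sqrt_smul (r' := (p - (a - 1)) / (a - 1 + 2 * n)) (by push_cast; rfl)
        (by push_cast; positivity) (by push_cast; positivity) (by positivity) ?_
      rw [hC, hC1]; push_cast; field_simp; ring
    · rw [show (2 * n - 1 : ℤ) = 2 * (n - 1) + 1 by ring]
      rw [fO1, G2_odd p]
      refine smul_sqrt_mul_sqrt_smul (r' := p + 2 * n) (by push_cast; rfl)
        (by push_cast; positivity) (by push_cast; positivity) (by positivity) ?_
      rw [hD, hD1]; push_cast; field_simp; ring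
  · rw [fE1_eq_zero h, map_zero]
    rcases eq_or_ne a (p + 1) with rfl | ha'
    · simp (disch := omega) [fO1_eq_zero]
    · simp (disch := omega) [fE0_eq_zero, fO1_eq_zero]

theorem c2_minus_fO1 (ha : 1 ≤ a) :
    c 1 (-1) (fO1 e a n) =
      ((p - (a - 1)) / (a + 2 * n + 1) : ℂ) • fO0 e (a - 1) n - (1 : ℂ) • fE1 e a n := by
  by_cases h : 1 ≤ a ∧ a ≤ p ∧ 0 ≤ n
  · obtain ⟨ha0, ha1, hpa, hpa1, hn0, hl, hb, hpb⟩ := label_bounds h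
    obtain ⟨C, hC, hC1⟩ := normA_step p (a := a - 1) (by omega)
    rw [sub_add_cancel] at hC1
    rw [fO1, map_smul, H.c2_minus_ket_one (admissible_one h.1 h.2.1 (by omega))]
    rw [smul_sub]
    congr 1
    · rw [fO0, G1_odd p (by omega)]
      refine smul_sqrt_mul_sqrt_smul (r' := (p - (a - 1)) / (a + 2 * n + 1)) (by push_cast; rfl)
        (by push_cast; positivity) (by push_cast; positivity) (by positivity) ?_
      rw [hC, hC1]; push_cast; field_simp; ring
    · rw [add_sub_cancel_right]
      rw [fE1, G2_even p]
      refine smul_sqrt_mul_sqrt_smul (r' := 1) (by push_cast; rfl)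
        (by push_cast; positivity) (by positivity) (by positivity) ?_
      push_cast; field_simp
  · rw [fO1_eq_zero h, map_zero]
    rcases eq_or_ne a (p + 1) with rfl | ha'
    · simp (disch := omega) [fE1_eq_zero]
    · simp (disch := omega) [fO0_eq_zero, fE1_eq_zero]

end GZAction

end Rescaled

/-! ### The action on the vacuum and on the vectors of level one -/

section Vacuum

variable {V : Type*} [NormedAddCommGroup V] [InnerProductSpace ℂ V] {p : ℕ}
  {c : Fin 2 → ℤˣ → Module.End ℂ V} {e : GZLabel p → V}

theorem admissible_vac : Admissible p 0 0 0 := (vacLabel p).adm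

omit [InnerProductSpace ℂ V] in
theorem ket_vacLabel (e : GZLabel p → V) : ket e 0 0 0 = e (vacLabel p) := ket_eq _

theorem fE0_one_zero (e : GZLabel p → V) : fE0 e 1 0 = ((√p : ℝ) : ℂ) • ket e 1 0 1 := by
  simp [fE0, normA, normB]

theorem fE1_one_zero (e : GZLabel p → V) : fE1 e 1 0 = ((√p : ℝ) : ℂ) • ket e 1 0 0 := by
  simp [fE1, normA, normB]

theorem ofReal_sqrt_mul_self (p : ℕ) : ((√(p : ℝ) : ℝ) : ℂ) * ((√(p : ℝ) : ℝ) : ℂ) = p := by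
  rw [← Complex.ofReal_mul, Real.mul_self_sqrt (Nat.cast_nonneg p), Complex.ofReal_natCast]

theorem G1_zero_zero (p : ℕ) : G1 p 0 0 = √p := by simp [G1]

namespace GZAction

variable (H : GZAction p c e)
include H

theorem c1_plus_vac : c 0 1 (e (vacLabel p)) = fE0 e 1 0 := by
  rw [← ket_vacLabel e, H.c1_plus_ket_zero admissible_vac, G1_zero_zero, fE0_one_zero, zero_add]

theorem c2_plus_vac : c 1 1 (e (vacLabel p)) = fE1 e 1 0 := by
  rw [← ket_vacLabel e, H.c2_plus_ket_zero admissible_vac, G1_zero_zero, fE1_one_zero]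
  simp

theorem c1_minus_vac : c 0 (-1) (e (vacLabel p)) = 0 := by
  rw [← ket_vacLabel e, H.c1_minus_ket_zero admissible_vac, ket_eq_zero (by simp [Admissible]),
    ket_eq_zero (by simp [Admissible])]
  simp

theorem c2_minus_vac : c 1 (-1) (e (vacLabel p)) = 0 := by
  rw [← ket_vacLabel e, H.c2_minus_ket_zero admissible_vac, ket_eq_zero (by simp [Admissible]),
    smul_zero]

variable (hp : 1 ≤ p)
include hp

theorem c1_minus_fE0_one_zero : c 0 (-1) (fE0 e 1 0) = (p : ℂ) • e (vacLabel p) := by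
  have h : Admissible p 1 0 1 := admissible_zero le_rfl (by exact_mod_cast hp) le_rfl
  rw [fE0_one_zero, map_smul, H.c1_minus_ket_zero h, ket_eq_zero (b := 0 - 1) (by simp [Admissible]),
    smul_zero, sub_zero, sub_self, G1_zero_zero, ket_vacLabel, smul_smul, ofReal_sqrt_mul_self]

theorem c1_minus_fE1_one_zero : c 0 (-1) (fE1 e 1 0) = 0 := by
  have h : Admissible p 1 0 (1 - 1) := admissible_one le_rfl (by exact_mod_cast hp) le_rfl
  have h' := H.c1_minus_ket_one h
  rw [sub_self] at h'
  rw [fE1_one_zero, map_smul, h', ket_eq_zero (by simp [Admissible]), smul_zero, smul_zero]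

theorem c2_minus_fE0_one_zero : c 1 (-1) (fE0 e 1 0) = 0 := by
  have h : Admissible p 1 0 1 := admissible_zero le_rfl (by exact_mod_cast hp) le_rfl
  rw [fE0_one_zero, map_smul, H.c2_minus_ket_zero h, ket_eq_zero (by simp [Admissible]), smul_zero,
    smul_zero]

theorem c2_minus_fE1_one_zero : c 1 (-1) (fE1 e 1 0) = (p : ℂ) • e (vacLabel p) := by
  have h : Admissible p 1 0 (1 - 1) := admissible_one le_rfl (by exact_mod_cast hp) le_rfl
  have h' := H.c2_minus_ket_one h
  rw [sub_self, ket_eq_zero (b := 0 - 1) (by simp [Admissible]), smul_zero, sub_zero,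
    G1_zero_zero, ket_vacLabel] at h'
  rw [fE1_one_zero, map_smul, h', smul_smul]
  simp [ofReal_sqrt_mul_self]

end GZAction

end Vacuum

/-! ### Ten operator identities, verified on the rescaled vectors -/

section Identities

variable {V : Type*} [NormedAddCommGroup V] [InnerProductSpace ℂ V] {p : ℕ}
  {c : Fin 2 → ℤˣ → Module.End ℂ V} {e : GZLabel p → V}

/-- The even Cartan operator `[c_1^-, c_1^+]`. -/
def cartan1 (c : Fin 2 → ℤˣ → Module.End ℂ V) : Module.End ℂ V :=
  c 0 (-1) * c 0 1 - c 0 1 * c 0 (-1)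

/-- The even Cartan operator `{c_2^-, c_2^+}`. -/
def cartan2 (c : Fin 2 → ℤˣ → Module.End ℂ V) : Module.End ℂ V :=
  c 1 (-1) * c 1 1 + c 1 1 * c 1 (-1)

/-- The weights are positive when `1 ≤ a ≤ p` and `0 ≤ n`, so the rescaling can be inverted. The
value of `μ_11` is recorded because the eigenvalues are stated through it. -/
theorem exists_rescaled (e : GZLabel p → V) (μ : GZLabel p) : μ = vacLabel p ∨
    (1 ≤ μ.m12 ∧ μ.m12 ≤ p ∧ ∃ n : ℤ, 0 ≤ n ∧ ∃ r : ℂ,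
      ((e μ = r • fE0 e μ.m12 n ∧ μ.m11 = μ.m12) ∨
      (e μ = r • fO0 e μ.m12 n ∧ μ.m11 = μ.m12) ∨
      (e μ = r • fE1 e μ.m12 n ∧ μ.m11 = μ.m12 - 1) ∨
      (e μ = r • fO1 e μ.m12 n ∧ μ.m11 = μ.m12 - 1))) := by
  obtain ⟨a, b, m, h⟩ := μ
  rcases eq_or_ne a 0 with rfl | ha
  · left
    obtain ⟨h1, h2, h3, h4, h5, h6⟩ := h
    obtain rfl : b = 0 := by omega
    obtain rfl : m = 0 := by omega
    rfl
  right
  have ha1 : 1 ≤ a := by have := h.2.1; omega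
  have hap : a ≤ p := h.2.2.1
  have hb : 0 ≤ b := h.1
  refine ⟨ha1, hap, ?_⟩
  have key : ∀ x : ℝ, 0 < x → e ⟨a, b, m, h⟩ =
      (((√x : ℝ) : ℂ))⁻¹ • ((√x : ℝ) : ℂ) • ket e a b m := by
    intro x hx
    have : ((√x : ℝ) : ℂ) ≠ 0 := by exact_mod_cast (Real.sqrt_pos.2 hx).ne'
    rw [inv_smul_smul₀ this, ket_eq h]
  have hA := normA_pos p ha1 hap
  have ha' : (1 : ℝ) ≤ a := by exact_mod_cast ha1
  have hm : m = a ∨ m = a - 1 := by have := h.2.2.2.2.1; omega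
  rcases Int.even_or_odd' b with ⟨n, rfl | rfl⟩
  · have hn : 0 ≤ n := by omega
    have hB := normB_pos p hn
    have hn' : (0 : ℝ) ≤ n := by exact_mod_cast hn
    rcases hm with rfl | rfl
    · exact ⟨n, hn, _, Or.inl ⟨key (normA p m * normB p n * (m + 2 * n)) (by positivity), rfl⟩⟩
    · exact ⟨n, hn, _, Or.inr (Or.inr (Or.inl
        ⟨key (normA p a * normB p n) (by positivity), rfl⟩))⟩
  · have hn : 0 ≤ n := by omega
    have hB := normB_pos p hn
    have hn' : (0 : ℝ) ≤ n := by exact_mod_cast hn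
    rcases hm with rfl | rfl
    · exact ⟨n, hn, _, Or.inr (Or.inl ⟨key (normA p m * normB p n) (by positivity), rfl⟩)⟩
    · exact ⟨n, hn, _, Or.inr (Or.inr (Or.inr
        ⟨key (normA p a * normB p n / (a + 2 * n + 1)) (by positivity), rfl⟩))⟩

/-- Case distinction on the rescaled basis vectors, with the exceptional pair `(1, 0)`. -/
theorem forall_rescaled {P Q : ℤ → ℤ → Prop} (h10 : P 1 0)
    (h : ∀ (a n : ℤ) (l : ℂ), 1 ≤ a → 0 ≤ n → (a : ℂ) = l - 2 * n → l ≠ 0 → 1 + l ≠ 0 →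
      2 + l ≠ 0 → 3 + l ≠ 0 → 4 + l ≠ 0 → (¬ (a = 1 ∧ n = 0) → -1 + l ≠ 0 → P a n) ∧ Q a n)
    (a n : ℤ) (ha : 1 ≤ a) (hn : 0 ≤ n) : P a n ∧ Q a n := by
  -- The level `l = a + 2 n` replaces `a` as a variable, so that every denominator normalizes to the
  -- form `k + l` with a listed nonvanishing hypothesis. The value `k = -1` fails only at `(1, 0)`.
  have hne : ∀ k : ℤ, k + (a + 2 * n) ≠ 0 → (k : ℂ) + ((a + 2 * n : ℤ) : ℂ) ≠ 0 :=
    fun k hk => by exact_mod_cast hk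
  have h' := h a n ((a + 2 * n : ℤ) : ℂ) ha hn (by push_cast; ring)
    (by simpa using! hne 0 (by omega)) (by simpa using! hne 1 (by omega))
    (by simpa using! hne 2 (by omega)) (by simpa using! hne 3 (by omega))
    (by simpa using! hne 4 (by omega))
  refine ⟨?_, h'.2⟩
  by_cases he : a = 1 ∧ n = 0
  · obtain ⟨rfl, rfl⟩ := he
    exact h10
  · exact h'.1 he (by simpa using! hne (-1) (by omega))

/-- Operators that agree on the vacuum and on the rescaled basis vectors are equal. -/
theorem ext_rescaled (he : Submodule.span ℂ (Set.range e) = ⊤) {S T : Module.End ℂ V}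
    (hv : S (e (vacLabel p)) = T (e (vacLabel p)))
    (h : ∀ a n : ℤ, 1 ≤ a → 0 ≤ n →
      (S (fE0 e a n) = T (fE0 e a n) ∧ S (fE1 e a n) = T (fE1 e a n)) ∧
      S (fO0 e a n) = T (fO0 e a n) ∧ S (fO1 e a n) = T (fO1 e a n)) : S = T := by
  refine LinearMap.ext_on_range he fun μ => ?_
  rcases exists_rescaled e μ with rfl | ⟨ha, -, n, hn, r, h'⟩
  · exact hv
  · obtain ⟨⟨h1, h2⟩, h3, h4⟩ := h μ.m12 n ha hn
    rcases h' with ⟨h', -⟩ | ⟨h', -⟩ | ⟨h', -⟩ | ⟨h', -⟩ <;> rw [h', map_smul, map_smul] <;>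
      congr 1

namespace GZAction

variable (H : GZAction p c e)
include H

theorem cartan1_vac (hp : 1 ≤ p) : cartan1 c (e (vacLabel p)) = (p : ℂ) • e (vacLabel p) := by
  simp [cartan1, H.c1_plus_vac, H.c1_minus_vac, H.c1_minus_fE0_one_zero hp]

/-- The eigenvalue is `p - 2 μ_11`. It holds for all integers `a`, `n`, since vectors outside the
range vanish, and so serves as a rewrite rule without side conditions. -/
theorem cartan1_rescaled (hp : 1 ≤ p) (a n : ℤ) :
    (cartan1 c (fE0 e a n) = (p - 2 * a : ℂ) • fE0 e a n ∧
      cartan1 c (fE1 e a n) = (p - 2 * (a - 1) : ℂ) • fE1 e a n) ∧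
    cartan1 c (fO0 e a n) = (p - 2 * a : ℂ) • fO0 e a n ∧
      cartan1 c (fO1 e a n) = (p - 2 * (a - 1) : ℂ) • fO1 e a n := by
  by_cases h : 1 ≤ a ∧ a ≤ p ∧ 0 ≤ n
  · obtain ⟨ha, -, hn⟩ := h
    revert a n
    refine forall_rescaled ?_ fun a n l ha hn hl h0 h1 h2 h3 h4 =>
      ⟨fun h10 h5 => ⟨?_, ?_⟩, ?_, ?_⟩
    · constructor <;> simp (disch := omega) only [cartan1, Module.End.mul_apply,
        LinearMap.sub_apply, map_sub, map_smul,
        add_sub_cancel_right, H.c1_plus_fE0, H.c1_plus_fE1, 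
        H.c1_minus_fE0, H.c1_minus_fE1, H.c1_minus_fO0, 
        H.c1_plus_vac, H.c1_minus_fE0_one_zero hp, H.c1_minus_fE1_one_zero hp,
        fO0_eq_zero, fO1_eq_zero, smul_zero, map_zero, sub_zero, zero_sub,
] <;>
        push_cast <;> match_scalars <;> ring
    all_goals
      simp (disch := omega) only [cartan1, Module.End.mul_apply, LinearMap.sub_apply, map_sub,
          map_smul, sub_add_cancel, add_sub_cancel_right, H.c1_plus_fE0, H.c1_plus_fE1,
          H.c1_plus_fO0, H.c1_plus_fO1, H.c1_minus_fE0, H.c1_minus_fE1, H.c1_minus_fO0,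
          H.c1_minus_fO1]
      push_cast
      simp only [hl]
      match_scalars <;> (try ring_nf) <;> (try field_simp) <;> ring
  · simp [fE0_eq_zero h, fE1_eq_zero h, fO0_eq_zero h, fO1_eq_zero h]

theorem cartan2_vac (hp : 1 ≤ p) : cartan2 c (e (vacLabel p)) = (p : ℂ) • e (vacLabel p) := by
  simp [cartan2, H.c2_plus_vac, H.c2_minus_vac, H.c2_minus_fE1_one_zero hp]

theorem cartan2_rescaled (hp : 1 ≤ p) (a n : ℤ) :
    (cartan2 c (fE0 e a n) = (p + 4 * n : ℂ) • fE0 e a n ∧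
      cartan2 c (fE1 e a n) = (p + 2 * (2 * n + 1) : ℂ) • fE1 e a n) ∧
    cartan2 c (fO0 e a n) = (p + 2 * (2 * n + 1) : ℂ) • fO0 e a n ∧
      cartan2 c (fO1 e a n) = (p + 2 * (2 * n + 2) : ℂ) • fO1 e a n := by
  by_cases h : 1 ≤ a ∧ a ≤ p ∧ 0 ≤ n
  · obtain ⟨ha, -, hn⟩ := h
    revert a n
    refine forall_rescaled ?_ fun a n l ha hn hl h0 h1 h2 h3 h4 =>
      ⟨fun h10 h5 => ⟨?_, ?_⟩, ?_, ?_⟩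
    · constructor <;> simp (disch := omega) only [cartan2, Module.End.mul_apply,
        LinearMap.add_apply, map_add, map_smul,
        map_neg, add_sub_cancel_right, H.c2_plus_fE0, H.c2_plus_fE1, 
        H.c2_minus_fE1, H.c2_minus_fO0, H.c2_minus_fO1,
        H.c2_plus_vac, H.c2_minus_fE0_one_zero hp, H.c2_minus_fE1_one_zero hp,
        fO0_eq_zero, fO1_eq_zero, smul_zero, map_zero, sub_zero, zero_sub,
        add_zero] <;>
        push_cast <;> match_scalars <;> ring
    all_goals
      simp (disch := omega) only [cartan2, Module.End.mul_apply, LinearMap.add_apply, map_sub,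
          map_add, map_smul, map_neg, sub_add_cancel, add_sub_cancel_right, H.c2_plus_fE0,
          H.c2_plus_fE1, H.c2_plus_fO0, H.c2_plus_fO1, H.c2_minus_fE0, H.c2_minus_fE1,
          H.c2_minus_fO0, H.c2_minus_fO1]
      push_cast
      simp only [hl]
      match_scalars <;> (try ring_nf) <;> (try field_simp) <;> ring
  · simp [fE0_eq_zero h, fE1_eq_zero h, fO0_eq_zero h, fO1_eq_zero h]

variable (hp : 1 ≤ p) (he : Submodule.span ℂ (Set.range e) = ⊤)
include hp he

/-- This and the following nine identities suffice for all the relations. Each contains, beside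
Cartan operators already known to be diagonal, at most one annihilation operator per term, so only
the vacuum and the pair `(1, 0)` need special formulas. -/
theorem cartan1_mul_c1_plus :
    cartan1 c * c 0 1 - c 0 1 * cartan1 c = (-2 : ℂ) • c 0 1 := by
  refine ext_rescaled he ?_ (forall_rescaled ⟨?_, ?_⟩ fun a n l ha hn hl h0 h1 h2 h3 h4 =>
    ⟨fun h10 h5 => ⟨?_, ?_⟩, ?_, ?_⟩)
  iterate 3
    · simp (disch := omega) only [Module.End.mul_apply, LinearMap.sub_apply, LinearMap.smul_apply,
        map_sub, map_smul, H.c1_plus_fE0, H.c1_plus_fE1, H.c1_plus_vac, H.cartan1_rescaled hp,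
        H.cartan1_vac hp] <;>
        push_cast <;> match_scalars <;> ring
  all_goals
    simp (disch := omega) only [Module.End.mul_apply, LinearMap.sub_apply, LinearMap.smul_apply,
        map_sub, map_smul, H.c1_plus_fE0, H.c1_plus_fE1, H.c1_plus_fO0, H.c1_plus_fO1,
        H.cartan1_rescaled hp]
    push_cast
    simp only [hl]
    match_scalars <;> (try ring_nf) <;> (try field_simp) <;> ring

theorem cartan1_mul_c2_plus :
    cartan1 c * c 1 1 = c 1 1 * cartan1 c := by
  refine ext_rescaled he ?_ (forall_rescaled ⟨?_, ?_⟩ fun a n l ha hn hl h0 h1 h2 h3 h4 =>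
    ⟨fun h10 h5 => ⟨?_, ?_⟩, ?_, ?_⟩)
  iterate 3
    · simp (disch := omega) only [Module.End.mul_apply, map_add, map_smul, map_neg, H.c2_plus_fE0,
        H.c2_plus_fE1, H.c2_plus_vac, H.cartan1_rescaled hp, H.cartan1_vac hp] <;>
        push_cast <;> match_scalars <;> ring
  all_goals
    simp (disch := omega) only [Module.End.mul_apply, map_add, map_smul, map_neg, H.c2_plus_fE0,
        H.c2_plus_fE1, H.c2_plus_fO0, H.c2_plus_fO1, H.cartan1_rescaled hp]
    push_cast
    simp only [hl]
    match_scalars <;> (try ring_nf) <;> (try field_simp) <;> ring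

theorem cartan2_mul_c1_plus :
    cartan2 c * c 0 1 = c 0 1 * cartan2 c := by
  refine ext_rescaled he ?_ (forall_rescaled ⟨?_, ?_⟩ fun a n l ha hn hl h0 h1 h2 h3 h4 =>
    ⟨fun h10 h5 => ⟨?_, ?_⟩, ?_, ?_⟩)
  iterate 3
    · simp (disch := omega) only [Module.End.mul_apply, map_sub, map_smul, H.c1_plus_fE0,
        H.c1_plus_fE1, H.c1_plus_vac, H.cartan2_rescaled hp, H.cartan2_vac hp] <;>
        push_cast <;> match_scalars <;> ring
  all_goals
    simp (disch := omega) only [Module.End.mul_apply, map_sub, map_smul, H.c1_plus_fE0,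
        H.c1_plus_fE1, H.c1_plus_fO0, H.c1_plus_fO1, H.cartan2_rescaled hp]
    push_cast
    simp only [hl]
    match_scalars <;> (try ring_nf) <;> (try field_simp) <;> ring

theorem cartan2_mul_c2_plus :
    cartan2 c * c 1 1 - c 1 1 * cartan2 c = (2 : ℂ) • c 1 1 := by
  refine ext_rescaled he ?_ (forall_rescaled ⟨?_, ?_⟩ fun a n l ha hn hl h0 h1 h2 h3 h4 =>
    ⟨fun h10 h5 => ⟨?_, ?_⟩, ?_, ?_⟩)
  iterate 3
    · simp (disch := omega) only [Module.End.mul_apply, LinearMap.sub_apply, LinearMap.smul_apply,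
        map_add, map_smul, map_neg, H.c2_plus_fE0, H.c2_plus_fE1, H.c2_plus_vac,
        H.cartan2_rescaled hp, H.cartan2_vac hp] <;>
        push_cast <;> match_scalars <;> ring
  all_goals
    simp (disch := omega) only [Module.End.mul_apply, LinearMap.sub_apply, LinearMap.smul_apply,
        map_add, map_smul, map_neg, H.c2_plus_fE0, H.c2_plus_fE1, H.c2_plus_fO0, H.c2_plus_fO1,
        H.cartan2_rescaled hp]
    push_cast
    simp only [hl]
    match_scalars <;> (try ring_nf) <;> (try field_simp) <;> ring

theorem sq_mul_c1_plus :
    c 1 1 * c 1 1 * c 0 1 = c 0 1 * (c 1 1 * c 1 1) := by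
  refine ext_rescaled he ?_ (forall_rescaled ⟨?_, ?_⟩ fun a n l ha hn hl h0 h1 h2 h3 h4 =>
    ⟨fun h10 h5 => ⟨?_, ?_⟩, ?_, ?_⟩)
  iterate 3
    · simp (disch := omega) only [Module.End.mul_apply, map_sub, map_add, map_smul, map_neg,
        H.c1_plus_fE0, H.c1_plus_fE1, H.c1_plus_fO1, H.c2_plus_fE0, H.c2_plus_fE1, H.c2_plus_fO0,
        H.c2_plus_fO1, H.c1_plus_vac, H.c2_plus_vac, zero_add] <;>
        push_cast <;> match_scalars <;> ring
  all_goals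
    simp (disch := omega) only [Module.End.mul_apply, map_sub, map_add, map_smul, map_neg,
        H.c1_plus_fE0, H.c1_plus_fE1, H.c1_plus_fO0, H.c1_plus_fO1, H.c2_plus_fE0, H.c2_plus_fE1,
        H.c2_plus_fO0, H.c2_plus_fO1]
    push_cast
    simp only [hl]
    match_scalars <;> (try ring_nf) <;> (try field_simp) <;> ring

theorem sq_mul_c1_minus :
    c 1 1 * c 1 1 * c 0 (-1) = c 0 (-1) * (c 1 1 * c 1 1) := by
  refine ext_rescaled he ?_ (forall_rescaled ⟨?_, ?_⟩ fun a n l ha hn hl h0 h1 h2 h3 h4 =>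
    ⟨fun h10 h5 => ⟨?_, ?_⟩, ?_, ?_⟩)
  iterate 3
    · simp (disch := omega) only [Module.End.mul_apply, map_add, map_smul, map_neg,
        add_sub_cancel_right, H.c2_plus_fE0, H.c2_plus_fE1, H.c2_plus_fO0, H.c2_plus_fO1,
        H.c1_minus_fE0, H.c1_minus_fE1, H.c1_minus_fO1, H.c2_plus_vac, H.c1_minus_vac,
        H.c1_minus_fE0_one_zero hp, H.c1_minus_fE1_one_zero hp, fE0_eq_zero, fE1_eq_zero,
        fO1_eq_zero, smul_zero, map_zero, zero_sub, zero_add] <;>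
        push_cast <;> match_scalars <;> ring
  all_goals
    simp (disch := omega) only [Module.End.mul_apply, map_sub, map_add, map_smul, map_neg,
        sub_add_cancel, add_sub_cancel_right, H.c2_plus_fE0, H.c2_plus_fE1, H.c2_plus_fO0,
        H.c2_plus_fO1, H.c1_minus_fE0, H.c1_minus_fE1, H.c1_minus_fO0, H.c1_minus_fO1]
    push_cast
    simp only [hl]
    match_scalars <;> (try ring_nf) <;> (try field_simp) <;> ring

theorem comm_plus_plus_mul_c1_plus :
    (c 0 1 * c 1 1 - c 1 1 * c 0 1) * c 0 1 = c 0 1 * (c 0 1 * c 1 1 - c 1 1 * c 0 1) := by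
  refine ext_rescaled he ?_ (forall_rescaled ⟨?_, ?_⟩ fun a n l ha hn hl h0 h1 h2 h3 h4 =>
    ⟨fun h10 h5 => ⟨?_, ?_⟩, ?_, ?_⟩)
  iterate 3
    · simp (disch := omega) only [Module.End.mul_apply, LinearMap.sub_apply, map_sub, map_add,
        map_smul, map_neg, H.c1_plus_fE0, H.c1_plus_fE1, H.c1_plus_fO0, H.c1_plus_fO1,
        H.c2_plus_fE0, H.c2_plus_fE1, H.c2_plus_fO0, H.c1_plus_vac, H.c2_plus_vac, zero_add] <;>
        push_cast <;> match_scalars <;> ring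
  all_goals
    simp (disch := omega) only [Module.End.mul_apply, LinearMap.sub_apply, map_sub, map_add,
        map_smul, map_neg, H.c1_plus_fE0, H.c1_plus_fE1, H.c1_plus_fO0, H.c1_plus_fO1,
        H.c2_plus_fE0, H.c2_plus_fE1, H.c2_plus_fO0, H.c2_plus_fO1]
    push_cast
    simp only [hl]
    match_scalars <;> (try ring_nf) <;> (try field_simp) <;> ring

theorem comm_plus_minus_mul_c1_plus :
    (c 0 1 * c 1 (-1) - c 1 (-1) * c 0 1) * c 0 1 =
      c 0 1 * (c 0 1 * c 1 (-1) - c 1 (-1) * c 0 1) := by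
  refine ext_rescaled he ?_ (forall_rescaled ⟨?_, ?_⟩ fun a n l ha hn hl h0 h1 h2 h3 h4 =>
    ⟨fun h10 h5 => ⟨?_, ?_⟩, ?_, ?_⟩)
  iterate 3
    · simp (disch := omega) only [Module.End.mul_apply, LinearMap.sub_apply, map_sub, map_smul,
        add_sub_cancel_right, H.c1_plus_fE0, H.c1_plus_fE1, H.c1_plus_fO0, H.c2_minus_fE0,
        H.c2_minus_fE1, H.c2_minus_fO0, H.c1_plus_vac, H.c2_minus_vac, H.c2_minus_fE0_one_zero hp,
        H.c2_minus_fE1_one_zero hp, fO0_eq_zero, fO1_eq_zero, smul_zero, map_zero, sub_zero,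
        zero_sub] <;>
        push_cast <;> match_scalars <;> ring
  all_goals
    simp (disch := omega) only [Module.End.mul_apply, LinearMap.sub_apply, map_sub, map_smul,
        sub_add_cancel, add_sub_cancel_right, H.c1_plus_fE0, H.c1_plus_fE1, H.c1_plus_fO0,
        H.c1_plus_fO1, H.c2_minus_fE0, H.c2_minus_fE1, H.c2_minus_fO0, H.c2_minus_fO1]
    push_cast
    simp only [hl]
    match_scalars <;> (try ring_nf) <;> (try field_simp) <;> ring

theorem comm_plus_plus_mul_c1_minus :
    (c 0 1 * c 1 1 - c 1 1 * c 0 1) * c 0 (-1) - c 0 (-1) * (c 0 1 * c 1 1 - c 1 1 * c 0 1) =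
      (-2 : ℂ) • c 1 1 := by
  refine ext_rescaled he ?_ (forall_rescaled ⟨?_, ?_⟩ fun a n l ha hn hl h0 h1 h2 h3 h4 =>
    ⟨fun h10 h5 => ⟨?_, ?_⟩, ?_, ?_⟩)
  iterate 3
    · simp (disch := omega) only [Module.End.mul_apply, LinearMap.sub_apply, LinearMap.smul_apply,
        map_sub, map_add, map_smul, map_neg, add_sub_cancel_right, H.c1_plus_fE0, H.c1_plus_fE1,
        H.c1_plus_fO0, H.c1_plus_fO1, H.c2_plus_fE0, H.c2_plus_fE1, H.c2_plus_fO0, H.c1_minus_fE0,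
        H.c1_minus_fE1, H.c1_minus_fO0, H.c1_minus_fO1, H.c1_plus_vac, H.c2_plus_vac,
        H.c1_minus_vac, H.c1_minus_fE0_one_zero hp, H.c1_minus_fE1_one_zero hp, fE0_eq_zero,
        fO0_eq_zero, smul_zero, map_zero, zero_sub, zero_add] <;>
        push_cast <;> match_scalars <;> ring
  all_goals
    simp (disch := omega) only [Module.End.mul_apply, LinearMap.sub_apply, LinearMap.smul_apply,
        map_sub, map_add, map_smul, map_neg, sub_add_cancel, add_sub_cancel_right, H.c1_plus_fE0,
        H.c1_plus_fE1, H.c1_plus_fO0, H.c1_plus_fO1, H.c2_plus_fE0, H.c2_plus_fE1, H.c2_plus_fO0,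
        H.c2_plus_fO1, H.c1_minus_fE0, H.c1_minus_fE1, H.c1_minus_fO0, H.c1_minus_fO1]
    push_cast
    simp only [hl]
    match_scalars <;> (try ring_nf) <;> (try field_simp) <;> ring

theorem comm_plus_plus_mul_c2_minus :
    (c 0 1 * c 1 1 - c 1 1 * c 0 1) * c 1 (-1) + c 1 (-1) * (c 0 1 * c 1 1 - c 1 1 * c 0 1) =
      (-2 : ℂ) • c 0 1 := by
  refine ext_rescaled he ?_ (forall_rescaled ⟨?_, ?_⟩ fun a n l ha hn hl h0 h1 h2 h3 h4 =>
    ⟨fun h10 h5 => ⟨?_, ?_⟩, ?_, ?_⟩)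
  iterate 3
    · simp (disch := omega) only [Module.End.mul_apply, LinearMap.sub_apply, LinearMap.add_apply,
        LinearMap.smul_apply, map_sub, map_add, map_smul, map_neg, add_sub_cancel_right,
        H.c1_plus_fE0, H.c1_plus_fE1, H.c1_plus_fO0, H.c1_plus_fO1, H.c2_plus_fE0, H.c2_plus_fE1,
        H.c2_plus_fO0, H.c2_minus_fE0, H.c2_minus_fE1, H.c2_minus_fO0, H.c2_minus_fO1,
        H.c1_plus_vac, H.c2_plus_vac, H.c2_minus_vac, H.c2_minus_fE0_one_zero hp,
        H.c2_minus_fE1_one_zero hp, fO1_eq_zero, smul_zero, map_zero, sub_zero, zero_sub, zero_add] <;>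
        push_cast <;> match_scalars <;> ring
  all_goals
    simp (disch := omega) only [Module.End.mul_apply, LinearMap.sub_apply, LinearMap.add_apply,
        LinearMap.smul_apply, map_sub, map_add, map_smul, map_neg, sub_add_cancel,
        add_sub_cancel_right, H.c1_plus_fE0, H.c1_plus_fE1, H.c1_plus_fO0, H.c1_plus_fO1,
        H.c2_plus_fE0, H.c2_plus_fE1, H.c2_plus_fO0, H.c2_plus_fO1, H.c2_minus_fE0, H.c2_minus_fE1,
        H.c2_minus_fO0, H.c2_minus_fO1]
    push_cast
    simp only [hl]
    match_scalars <;> (try ring_nf) <;> (try field_simp) <;> ring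

end GZAction

end Identities

/-! ### Formal adjoints -/

section Adjoint

variable {V : Type*} [NormedAddCommGroup V] [InnerProductSpace ℂ V]

/-- `A'` is a formal adjoint of `A`. -/
def IsAdj (A A' : Module.End ℂ V) : Prop := ∀ x y, (inner ℂ (A x) y : ℂ) = inner ℂ x (A' y)

namespace IsAdj

variable {A B A' B' : Module.End ℂ V}

theorem mul (hA : IsAdj A A') (hB : IsAdj B B') : IsAdj (A * B) (B' * A') := fun x y => by
  rw [Module.End.mul_apply, hA, hB, Module.End.mul_apply]

theorem add (hA : IsAdj A A') (hB : IsAdj B B') : IsAdj (A + B) (A' + B') := fun x y => by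
  rw [LinearMap.add_apply, inner_add_left, hA, hB, LinearMap.add_apply, inner_add_right]

theorem sub (hA : IsAdj A A') (hB : IsAdj B B') : IsAdj (A - B) (A' - B') := fun x y => by
  rw [LinearMap.sub_apply, inner_sub_left, hA, hB, LinearMap.sub_apply, inner_sub_right]

theorem smul (r : ℝ) (hA : IsAdj A A') : IsAdj ((r : ℂ) • A) ((r : ℂ) • A') := fun x y => by
  rw [LinearMap.smul_apply, inner_smul_left, hA, LinearMap.smul_apply, inner_smul_right,
    Complex.conj_ofReal]

theorem two_smul (hA : IsAdj A A') : IsAdj ((2 : ℂ) • A) ((2 : ℂ) • A') := by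
  simpa using hA.smul 2

theorem neg_two_smul (hA : IsAdj A A') : IsAdj ((-2 : ℂ) • A) ((-2 : ℂ) • A') := by
  simpa using hA.smul (-2)

/-- A formal adjoint is unique because the inner product is nondegenerate; hence every operator
identity yields its adjoint identity. -/
theorem eq_of_eq (hA : IsAdj A A') (hB : IsAdj B B') (h : A = B) : A' = B' := by
  refine LinearMap.ext fun y => ext_inner_left ℂ fun x => ?_
  rw [← hA, ← hB, h]

end IsAdj

end Adjoint

/-! ### The parastatistics relations -/

section Relations

variable {V : Type*} [NormedAddCommGroup V] [InnerProductSpace ℂ V] {p : ℕ}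
  {c : Fin 2 → ℤˣ → Module.End ℂ V} {e : GZLabel p → V}

set_option maxHeartbeats 2000000 in
/-- The Gel'fand-Zetlin formulas and the adjointness relations imply the parastatistics
relations. -/
theorem GZAction.paraRelations (H : GZAction p c e) (hp : 1 ≤ p)
    (he : Submodule.span ℂ (Set.range e) = ⊤)
    (hadj : ∀ j ξ x y, (inner ℂ (c j ξ x) y : ℂ) = inner ℂ x (c j (-ξ) y)) :
    ParaRelations c := by
  have ha : IsAdj (c 0 1) (c 0 (-1)) := hadj 0 1
  have hb : IsAdj (c 1 1) (c 1 (-1)) := hadj 1 1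
  have ha' : IsAdj (c 0 (-1)) (c 0 1) := by simpa using! hadj 0 (-1)
  have hb' : IsAdj (c 1 (-1)) (c 1 1) := by simpa using! hadj 1 (-1)
  have hK1 : IsAdj (cartan1 c) (cartan1 c) := (ha'.mul ha).sub (ha.mul ha')
  have hK2 : IsAdj (cartan2 c) (cartan2 c) := (hb'.mul hb).add (hb.mul hb')
  have hab := (ha.mul hb).sub (hb.mul ha)
  have hab' := (ha.mul hb').sub (hb'.mul ha)
  have t0 := H.cartan1_mul_c1_plus hp he
  have t1 := H.cartan1_mul_c2_plus hp he
  have t2 := H.cartan2_mul_c1_plus hp he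
  have t3 := H.cartan2_mul_c2_plus hp he
  have t4 := H.sq_mul_c1_plus hp he
  have t5 := H.sq_mul_c1_minus hp he
  have t6 := H.comm_plus_plus_mul_c1_plus hp he
  have t7 := H.comm_plus_minus_mul_c1_plus hp he
  have t8 := H.comm_plus_plus_mul_c1_minus hp he
  have t9 := H.comm_plus_plus_mul_c2_minus hp he
  -- The adjoints of the ten identities exchange creation and annihilation operators; the Cartan
  -- operators are their own adjoints.
  have t10 := IsAdj.eq_of_eq ((hK1.mul ha).sub (ha.mul hK1)) (ha.neg_two_smul) t0
  have t11 := IsAdj.eq_of_eq (hK1.mul hb) (hb.mul hK1) t1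
  have t12 := IsAdj.eq_of_eq (hK2.mul ha) (ha.mul hK2) t2
  have t13 := IsAdj.eq_of_eq ((hK2.mul hb).sub (hb.mul hK2)) (hb.two_smul) t3
  have t14 := IsAdj.eq_of_eq ((hb.mul hb).mul ha) (ha.mul (hb.mul hb)) t4
  have t15 := IsAdj.eq_of_eq ((hb.mul hb).mul ha') (ha'.mul (hb.mul hb)) t5
  have t16 := IsAdj.eq_of_eq (hab.mul ha) (ha.mul hab) t6
  have t17 := IsAdj.eq_of_eq (hab'.mul ha) (ha.mul hab') t7
  have t18 := IsAdj.eq_of_eq ((hab.mul ha').sub (ha'.mul hab)) (hb.neg_two_smul) t8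
  have t19 := IsAdj.eq_of_eq ((hab.mul hb').add (hb'.mul hab)) (ha.neg_two_smul) t9
  simp only [cartan1, cartan2, mul_add, add_mul, mul_sub, sub_mul, mul_assoc
] at t0 t1 t2 t3 t4 t5 t6 t7 t8 t9 t10 t11 t12 t13 t14 t15 t16 t17 t18 t19
  have hne : (1 : ℤˣ) ≠ -1 := by decide
  have hne' : (-1 : ℤˣ) ≠ 1 := by decide
  intro j k l ξ η ε
  -- Of the 64 choices of indices and signs, those left by `simp` are linear combinations of the
  -- twenty identities, sometimes two at a time by the Jacobi identity.
  fin_cases j <;> fin_cases k <;> fin_cases l <;> rcases Int.units_eq_one_or ξ with rfl | rfl <;>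
    rcases Int.units_eq_one_or η with rfl | rfl <;> rcases Int.units_eq_one_or ε with rfl | rfl <;>
    simp [superBracket, deg, hne, hne', mul_add, add_mul, mul_sub, sub_mul, mul_assoc, smul_mul_assoc]
  · linear_combination (norm := module) -t0
  · linear_combination (norm := module) t10
  · linear_combination (norm := module) t0
  · linear_combination (norm := module) -t10
  · linear_combination (norm := module) -t1
  · linear_combination (norm := module) t11
  · linear_combination (norm := module) t1
  · linear_combination (norm := module) -t11
  · linear_combination (norm := module) t6
  · linear_combination (norm := module) t8
  · linear_combination (norm := module) t7
  · linear_combination (norm := module) t11 + t18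
  · linear_combination (norm := module) t1 + t8
  · linear_combination (norm := module) t17
  · linear_combination (norm := module) t18
  · linear_combination (norm := module) t16
  · linear_combination (norm := module) -t4
  · linear_combination (norm := module) t9
  · linear_combination (norm := module) -t2 - t9
  · linear_combination (norm := module) t15
  · linear_combination (norm := module) -t5
  · linear_combination (norm := module) t12 + t19
  · linear_combination (norm := module) -t19
  · linear_combination (norm := module) t14
  · linear_combination (norm := module) -t6
  · linear_combination (norm := module) -t8
  · linear_combination (norm := module) -t1 - t8
  · linear_combination (norm := module) -t17
  · linear_combination (norm := module) -t7
  · linear_combination (norm := module) -t11 - t18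
  · linear_combination (norm := module) -t18
  · linear_combination (norm := module) -t16
  · linear_combination (norm := module) t4
  · linear_combination (norm := module) -t9
  · linear_combination (norm := module) t5
  · linear_combination (norm := module) -t12 - t19
  · linear_combination (norm := module) t2 + t9
  · linear_combination (norm := module) -t15
  · linear_combination (norm := module) t19
  · linear_combination (norm := module) -t14
  · linear_combination (norm := module) (2 : ℂ) • t4
  · linear_combination (norm := module) (2 : ℂ) • t5
  · linear_combination (norm := module) t2
  · linear_combination (norm := module) -t12
  · linear_combination (norm := module) t2
  · linear_combination (norm := module) -t12
  · linear_combination (norm := module) (-2 : ℂ) • t15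
  · linear_combination (norm := module) (-2 : ℂ) • t14
  · linear_combination (norm := module) (-2 : ℂ) • t3
  · linear_combination (norm := module) t3
  · linear_combination (norm := module) -t13
  · linear_combination (norm := module) t3
  · linear_combination (norm := module) -t13
  · linear_combination (norm := module) (2 : ℂ) • t13

end Relations

/-! ### Cyclicity of the vacuum and irreducibility -/

section Cyclic

variable {V : Type*} [NormedAddCommGroup V] [InnerProductSpace ℂ V] {p : ℕ}
  {c : Fin 2 → ℤˣ → Module.End ℂ V} {e : GZLabel p → V}

theorem mem_of_smul_mem {S : Submodule ℂ V} {r : ℂ} (hr : r ≠ 0) {x : V} (h : r • x ∈ S) :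
    x ∈ S := (S.smul_mem_iff hr).1 h

namespace GZAction

variable (H : GZAction p c e) {W S : Submodule ℂ V} (hS : ∀ j, ∀ x ∈ W, c j 1 x ∈ S)
include H hS

/-- In `c_2^+ fE0 - c_1^+ fE1` the terms with `a + 1` cancel, and a nonzero multiple of `fO0`
remains. The same combination of `fO0` and `fO1` gives `fE0` with `n + 1`. -/
theorem fO0_mem {a n : ℤ} (ha : 1 ≤ a) (hn : 0 ≤ n) (h0 : fE0 e a n ∈ W) (h1 : fE1 e a n ∈ W) :
    fO0 e a n ∈ S := by
  have hr : ((a + 2 * n + 1 : ℤ) : ℂ) ≠ 0 := by exact_mod_cast (by omega : a + 2 * n + 1 ≠ 0)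
  have h := S.sub_mem (hS 1 _ h0) (hS 0 _ h1)
  rw [H.c2_plus_fE0 (by omega), H.c1_plus_fE1 (by omega)] at h
  refine mem_of_smul_mem hr ?_
  convert! h using 1
  push_cast
  module

theorem fO1_mem {a n : ℤ} (ha : 1 ≤ a) (hn : 0 ≤ n) (h1 : fE1 e a n ∈ W) : fO1 e a n ∈ S := by
  have hr : ((a + 2 * n + 1 : ℤ) : ℂ) ≠ 0 := by exact_mod_cast (by omega : a + 2 * n + 1 ≠ 0)
  have h := S.neg_mem (hS 1 _ h1)
  rw [H.c2_plus_fE1 (by omega), neg_neg] at h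
  refine mem_of_smul_mem hr ?_
  convert! h using 1
  push_cast
  module

theorem fE0_succ_mem {a n : ℤ} (ha : 1 ≤ a) (hn : 0 ≤ n) (h0 : fO0 e a n ∈ W)
    (h1 : fO1 e a n ∈ W) : fE0 e a (n + 1) ∈ S := by
  have hr0 : (2 * (n : ℂ) + 2) ≠ 0 := by exact_mod_cast (by omega : 2 * n + 2 ≠ 0)
  have hr1 : (a + 2 * n + 1 : ℂ) ≠ 0 := by exact_mod_cast (by omega : a + 2 * n + 1 ≠ 0)
  have hr2 : (a + 2 * n + 2 : ℂ) ≠ 0 := by exact_mod_cast (by omega : a + 2 * n + 2 ≠ 0)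
  have h := S.sub_mem (hS 1 _ h0) (hS 0 _ h1)
  rw [H.c2_plus_fO0 (by omega) (by omega), H.c1_plus_fO1 (by omega) (by omega)] at h
  refine mem_of_smul_mem (r := (2 * n + 2) / (a + 2 * n + 1)) (div_ne_zero hr0 hr1) ?_
  convert! h using 1
  match_scalars
  · field_simp
    ring
  · ring

theorem fE1_succ_mem {a n : ℤ} (ha : 1 ≤ a) (hn : 0 ≤ n) (h1 : fO1 e a n ∈ W) :
    fE1 e a (n + 1) ∈ S := by
  have hr0 : (2 * (n : ℂ) + 2) ≠ 0 := by exact_mod_cast (by omega : 2 * n + 2 ≠ 0)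
  have hr1 : (a + 2 * n + 1 : ℂ) ≠ 0 := by exact_mod_cast (by omega : a + 2 * n + 1 ≠ 0)
  have h := S.neg_mem (hS 1 _ h1)
  rw [H.c2_plus_fO1 (by omega) (by omega), neg_neg] at h
  exact mem_of_smul_mem (div_ne_zero hr0 hr1) h

variable (hSW : S ≤ W) (hv : e (vacLabel p) ∈ W)
include hSW hv

theorem fE_zero_mem {a : ℤ} (ha : 1 ≤ a) : fE0 e a 0 ∈ S ∧ fE1 e a 0 ∈ S := by
  induction a, ha using Int.leInduction with
  | base => exact ⟨H.c1_plus_vac ▸ hS 0 _ hv, H.c2_plus_vac ▸ hS 1 _ hv⟩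
  | succ a ha ih =>
    have hr : (a : ℂ) ≠ 0 := by exact_mod_cast (by omega : a ≠ 0)
    have hO := H.fO0_mem hS ha le_rfl (hSW ih.1) (hSW ih.2)
    have h0 := hS 0 _ (hSW ih.1)
    have h1 := S.sub_mem (hS 1 _ (hSW ih.1)) (S.smul_mem (a + 2 * (0 : ℤ) : ℂ) hO)
    rw [H.c1_plus_fE0 (by omega)] at h0
    rw [H.c2_plus_fE0 (by omega), add_sub_cancel_right] at h1
    exact ⟨mem_of_smul_mem hr h0, mem_of_smul_mem hr h1⟩

theorem fE_mem {a n : ℤ} (ha : 1 ≤ a) (hn : 0 ≤ n) : fE0 e a n ∈ S ∧ fE1 e a n ∈ S := by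
  induction n, hn using Int.leInduction with
  | base => exact H.fE_zero_mem hS hSW hv ha
  | succ n hn ih =>
    have h0 := hSW (H.fO0_mem hS ha hn (hSW ih.1) (hSW ih.2))
    have h1 := hSW (H.fO1_mem hS ha hn (hSW ih.2))
    exact ⟨H.fE0_succ_mem hS ha hn h0 h1, H.fE1_succ_mem hS ha hn h1⟩

/-- Two submodules are kept for two uses: `S = W` invariant gives cyclicity of the vacuum, while `W
= ⊤` with `S` the sum of the ranges of `c_1^+` and `c_2^+` shows that all other basis vectors lie in
these ranges. -/
theorem basis_mem {μ : GZLabel p} (hμ : μ ≠ vacLabel p) : e μ ∈ S := by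
  rcases exists_rescaled e μ with rfl | ⟨ha, -, n, hn, r, h⟩
  · exact absurd rfl hμ
  · have hE := H.fE_mem hS hSW hv ha hn
    rcases h with ⟨h, -⟩ | ⟨h, -⟩ | ⟨h, -⟩ | ⟨h, -⟩ <;> rw [h] <;> refine S.smul_mem r ?_
    · exact hE.1
    · exact H.fO0_mem hS ha hn (hSW hE.1) (hSW hE.2)
    · exact hE.2
    · exact H.fO1_mem hS ha hn (hSW hE.2)

end GZAction

/-- An invariant subspace that contains the vacuum is everything. -/
theorem GZAction.eq_top_of_vac_mem (H : GZAction p c e)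
    (he : Submodule.span ℂ (Set.range e) = ⊤) {W : Submodule ℂ V}
    (hW : ∀ j, ∀ x ∈ W, c j 1 x ∈ W) (hv : e (vacLabel p) ∈ W) : W = ⊤ := by
  rw [eq_top_iff, ← he, Submodule.span_le]
  rintro _ ⟨μ, rfl⟩
  rcases eq_or_ne μ (vacLabel p) with rfl | hμ
  · exact hv
  · exact H.basis_mem hW le_rfl hv hμ

/-- A vector that both annihilation operators kill is a multiple of the vacuum. -/
theorem GZAction.eq_smul_vac (H : GZAction p c e) (ho : Orthonormal ℂ e)
    (he : Submodule.span ℂ (Set.range e) = ⊤)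
    (hadj : ∀ j ξ x y, (inner ℂ (c j ξ x) y : ℂ) = inner ℂ x (c j (-ξ) y)) {x : V}
    (hx : ∀ j, c j (-1) x = 0) :
    x = (inner ℂ (e (vacLabel p)) x : ℂ) • e (vacLabel p) := by
  -- A vector killed by both annihilation operators is orthogonal to the ranges of their adjoints,
  -- hence to every basis vector except the vacuum.
  have hR : ∀ y ∈ LinearMap.range (c 0 1) ⊔ LinearMap.range (c 1 1), (inner ℂ y x : ℂ) = 0 := by
    intro y hy
    obtain ⟨_, ⟨u, rfl⟩, _, ⟨v, rfl⟩, rfl⟩ := Submodule.mem_sup.1 hy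
    rw [inner_add_left, hadj, hadj, hx, hx, inner_zero_right, inner_zero_right, add_zero]
  have hμ : ∀ μ ≠ vacLabel p, (inner ℂ (e μ) x : ℂ) = 0 := by
    intro μ hμ
    refine hR _ (H.basis_mem (W := ⊤) ?_ le_top trivial hμ)
    intro j y _
    fin_cases j
    · exact Submodule.mem_sup_left ⟨y, rfl⟩
    · exact Submodule.mem_sup_right ⟨y, rfl⟩
  rw [← sub_eq_zero]
  set z := x - (inner ℂ (e (vacLabel p)) x : ℂ) • e (vacLabel p) with hz
  have : ∀ y ∈ Submodule.span ℂ (Set.range e), (inner ℂ y z : ℂ) = 0 := by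
    intro y hy
    induction hy using Submodule.span_induction with
    | mem y h =>
      obtain ⟨μ, rfl⟩ := h
      rw [hz, inner_sub_right, inner_smul_right]
      rcases eq_or_ne μ (vacLabel p) with rfl | h
      · rw [inner_self_eq_norm_sq_to_K, ho.1]
        simp
      · rw [hμ μ h, ho.2 h, mul_zero, sub_zero]
    | zero => simp
    | add u v _ _ hu hv => rw [inner_add_left, hu, hv, add_zero]
    | smul r u _ hu => rw [inner_smul_left, hu, mul_zero]
  exact inner_self_eq_zero.1 (this z (he ▸ trivial))

/-- The span of the basis vectors of level less than `n`. -/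
def levelSpan (e : GZLabel p → V) (n : ℕ) : Submodule ℂ V :=
  Submodule.span ℂ (e '' {μ | μ.m12 + μ.m22 < n})

theorem ket_mem_levelSpan (e : GZLabel p → V) {a b m : ℤ} {n : ℕ} (h : a + b < n) :
    ket e a b m ∈ levelSpan e n := by
  by_cases hA : Admissible p a b m
  · rw [ket_eq hA]
    exact Submodule.subset_span ⟨_, h, rfl⟩
  · rw [ket_eq_zero hA]
    exact Submodule.zero_mem _

theorem levelSpan_zero (e : GZLabel p → V) : levelSpan e 0 = ⊥ := by
  rw [levelSpan, Submodule.span_eq_bot]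
  rintro _ ⟨μ, hμ, rfl⟩
  have h1 := μ.adm.1
  have h2 := μ.adm.2.1
  simp only [Set.mem_ofPred_eq] at hμ
  omega

theorem levelSpan_mono (e : GZLabel p → V) {m n : ℕ} (h : m ≤ n) :
    levelSpan e m ≤ levelSpan e n := by
  refine Submodule.span_mono (Set.image_mono fun μ hμ => ?_)
  simp only [Set.mem_ofPred_eq] at hμ ⊢
  omega

theorem exists_mem_levelSpan (he : Submodule.span ℂ (Set.range e) = ⊤) (x : V) :
    ∃ n, x ∈ levelSpan e n := by
  have hx : x ∈ Submodule.span ℂ (Set.range e) := he ▸ trivial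
  induction hx using Submodule.span_induction with
  | mem x h =>
    obtain ⟨μ, rfl⟩ := h
    exact ⟨(μ.m12 + μ.m22).toNat + 1, Submodule.subset_span ⟨μ, by
      simp only [Set.mem_ofPred_eq]; omega, rfl⟩⟩
  | zero => exact ⟨0, Submodule.zero_mem _⟩
  | add u v _ _ hu hv =>
    obtain ⟨m, hm⟩ := hu
    obtain ⟨n, hn⟩ := hv
    exact ⟨max m n, Submodule.add_mem _ (levelSpan_mono e (le_max_left _ _) hm)
      (levelSpan_mono e (le_max_right _ _) hn)⟩
  | smul r u _ hu =>
    obtain ⟨m, hm⟩ := hu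
    exact ⟨m, Submodule.smul_mem _ r hm⟩

theorem GZAction.minus_mem_levelSpan (H : GZAction p c e) (j : Fin 2) {n : ℕ} {x : V}
    (hx : x ∈ levelSpan e (n + 1)) : c j (-1) x ∈ levelSpan e n := by
  have : levelSpan e (n + 1) ≤ (levelSpan e n).comap (c j (-1)) := by
    refine Submodule.span_le.2 ?_
    rintro _ ⟨μ, hμ, rfl⟩
    simp only [Set.mem_ofPred_eq, Nat.cast_add, Nat.cast_one] at hμ
    have h1 : ∀ m, ket e (μ.m12 - 1) μ.m22 m ∈ levelSpan e n :=
      fun m => ket_mem_levelSpan e (by omega)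
    have h2 : ∀ m, ket e μ.m12 (μ.m22 - 1) m ∈ levelSpan e n :=
      fun m => ket_mem_levelSpan e (by omega)
    rw [SetLike.mem_coe, Submodule.mem_comap]
    fin_cases j
    · exact H.c1_minus μ ▸ Submodule.sub_mem _ (Submodule.smul_mem _ _ (h1 _))
        (Submodule.smul_mem _ _ (h2 _))
    · exact H.c2_minus μ ▸ Submodule.add_mem _ (Submodule.smul_mem _ _ (h1 _))
        (Submodule.smul_mem _ _ (h2 _))
  exact this hx

/-- From a nonzero vector of the invariant subspace, annihilation operators lower the level until a
nonzero vector killed by both appears; it is a multiple of the vacuum, which is cyclic. -/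
theorem GZAction.irreducible (H : GZAction p c e) (ho : Orthonormal ℂ e)
    (he : Submodule.span ℂ (Set.range e) = ⊤)
    (hadj : ∀ j ξ x y, (inner ℂ (c j ξ x) y : ℂ) = inner ℂ x (c j (-ξ) y))
    (W : Submodule ℂ V) (hW : ∀ j ξ, ∀ x ∈ W, c j ξ x ∈ W) : W = ⊥ ∨ W = ⊤ := by
  refine or_iff_not_imp_left.2 fun hne => H.eq_top_of_vac_mem he (fun j => hW j 1) ?_
  have key : ∀ n : ℕ, ∀ x ∈ W, x ≠ 0 → x ∈ levelSpan e n → e (vacLabel p) ∈ W := by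
    intro n
    induction n with
    | zero =>
      intro x _ hx h
      rw [levelSpan_zero, Submodule.mem_bot] at h
      exact absurd h hx
    | succ n ih =>
      intro x hxW hx h
      by_cases h0 : ∀ j, c j (-1) x = 0
      · have hs := H.eq_smul_vac ho he hadj h0
        have hr : (inner ℂ (e (vacLabel p)) x : ℂ) ≠ 0 := by
          intro h
          rw [h, zero_smul] at hs
          exact hx hs
        exact mem_of_smul_mem hr (hs ▸ hxW)
      · push Not at h0
        obtain ⟨j, hj⟩ := h0
        exact ih _ (hW j (-1) x hxW) hj (H.minus_mem_levelSpan j h)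
  obtain ⟨x, hxW, hx⟩ := Submodule.exists_mem_ne_zero_of_ne_bot hne
  obtain ⟨n, hn⟩ := exists_mem_levelSpan he x
  exact key n x hxW hx hn

end Cyclic

/-! ### Construction of the model -/

section Model

/-- The span of the standard Hilbert basis of `ℓ²`, not its closure: the basis must be algebraic for
the unbounded operators to be defined everywhere. -/
theorem exists_orthonormal_basis (ι : Type) : ∃ (V : Type) (_ : NormedAddCommGroup V)
    (_ : InnerProductSpace ℂ V) (b : Module.Basis ι ℂ V), Orthonormal ℂ b := by
  let B := HilbertBasis.ofRepr (LinearIsometryEquiv.refl ℂ (lp (fun _ : ι => ℂ) 2))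
  refine ⟨Submodule.span ℂ (Set.range B), inferInstance, inferInstance,
    Module.Basis.span B.orthonormal.linearIndependent, ?_⟩
  refine ⟨fun i => ?_, fun i j hij => ?_⟩
  · exact (congrArg norm (Module.Basis.span_apply _ i)).trans (B.orthonormal.1 i)
  · exact (congrArg₂ (inner ℂ) (Module.Basis.span_apply _ i) (Module.Basis.span_apply _ j)).trans
      (B.orthonormal.2 hij)

variable {p : ℕ} {V : Type*} [NormedAddCommGroup V] [InnerProductSpace ℂ V]
  (B : Module.Basis (GZLabel p) ℂ V)

/-- The image of a basis vector under `c_1^+`. -/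
def c1Plus (μ : GZLabel p) : V :=
  ((Real.sqrt ((μ.m12 + μ.m22) / (μ.m12 + μ.m22 + 1)) ^ μ.theta * G1 p μ.m12 μ.m22 : ℝ) : ℂ) •
      ket B (μ.m12 + 1) μ.m22 (μ.m11 + 1) -
  ((μ.theta * Real.sqrt (1 / (μ.m12 + μ.m22 + 1)) * G2 p μ.m12 μ.m22 : ℝ) : ℂ) •
      ket B μ.m12 (μ.m22 + 1) (μ.m11 + 1)

/-- The image of a basis vector under `c_2^+`. -/
def c2Plus (μ : GZLabel p) : V :=
  (((1 - μ.theta) * Real.sqrt (1 / (μ.m12 + μ.m22 + 1)) * G1 p μ.m12 μ.m22 : ℝ) : ℂ) •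
      ket B (μ.m12 + 1) μ.m22 μ.m11 +
  (((-1) ^ μ.theta * Real.sqrt ((μ.m12 + μ.m22) / (μ.m11 + μ.m22 + 1)) *
      G2 p μ.m12 μ.m22 : ℝ) : ℂ) •
      ket B μ.m12 (μ.m22 + 1) μ.m11

/-- The image of a basis vector under `c_1^-`. -/
def c1Minus (μ : GZLabel p) : V :=
  ((Real.sqrt ((μ.m12 + μ.m22 - 1) / (μ.m12 + μ.m22)) ^ μ.theta *
      G1 p (μ.m12 - 1) μ.m22 : ℝ) : ℂ) •
      ket B (μ.m12 - 1) μ.m22 (μ.m11 - 1) -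
  (((1 - μ.theta) * Real.sqrt (1 / (μ.m12 + μ.m22)) * G2 p μ.m12 (μ.m22 - 1) : ℝ) : ℂ) •
      ket B μ.m12 (μ.m22 - 1) (μ.m11 - 1)

/-- The image of a basis vector under `c_2^-`. -/
def c2Minus (μ : GZLabel p) : V :=
  ((μ.theta * Real.sqrt (1 / (μ.m12 + μ.m22)) * G1 p (μ.m12 - 1) μ.m22 : ℝ) : ℂ) •
      ket B (μ.m12 - 1) μ.m22 μ.m11 +
  (((-1) ^ μ.theta * Real.sqrt ((μ.m12 + μ.m22 - 1) / (μ.m11 + μ.m22)) *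
      G2 p μ.m12 (μ.m22 - 1) : ℝ) : ℂ) •
      ket B μ.m12 (μ.m22 - 1) μ.m11

/-- The operators of the model. -/
def modelOp (j : Fin 2) (ξ : ℤˣ) : Module.End ℂ V :=
  B.constr ℂ <|
    if j = 0 then (if ξ = 1 then c1Plus B else c1Minus B) else (if ξ = 1 then c2Plus B else c2Minus B)

theorem gzAction_model : GZAction p (modelOp B) B := by
  have h : (-1 : ℤˣ) ≠ 1 := by decide
  refine ⟨fun μ => ?_, fun μ => ?_, fun μ => ?_, fun μ => ?_⟩ <;>
    rw [modelOp, Module.Basis.constr_basis]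
  · rfl
  · rfl
  · simp only [if_true, h, if_false]
    rfl
  · simp only [Fin.isValue, one_ne_zero, h, if_false]
    rfl

variable (hB : Orthonormal ℂ B)

include hB in
theorem inner_ket_left (a b m : ℤ) (ν : GZLabel p) :
    (inner ℂ (ket B a b m) (B ν) : ℂ) =
      if a = ν.m12 ∧ b = ν.m22 ∧ m = ν.m11 then 1 else 0 := by
  classical
  obtain ⟨a', b', m', h'⟩ := ν
  by_cases h : Admissible p a b m
  · rw [ket_eq h, orthonormal_iff_ite.1 (hB)]
    simp only [GZLabel.mk.injEq]
  · rw [ket_eq_zero h, inner_zero_left, if_neg]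
    rintro ⟨rfl, rfl, rfl⟩
    exact h h'

include hB in
theorem inner_ket_right (a b m : ℤ) (ν : GZLabel p) :
    (inner ℂ (B ν) (ket B a b m) : ℂ) =
      if a = ν.m12 ∧ b = ν.m22 ∧ m = ν.m11 then 1 else 0 := by
  rw [← inner_conj_symm, inner_ket_left B hB]
  split_ifs <;> simp

theorem theta_eq (μ : GZLabel p) :
    (μ.theta = 0 ∧ μ.m11 = μ.m12) ∨ (μ.theta = 1 ∧ μ.m11 = μ.m12 - 1) := by
  have := μ.adm.2.2.2.2.1
  unfold GZLabel.theta
  omega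

include hB in
-- The matrices of `c_1^+` and `c_1^-` are real and transposes of each other; `θ` is unchanged in
-- the first term and drops from `1` to `0` in the second.
theorem inner_modelOp_one_plus (μ ν : GZLabel p) :
    (inner ℂ (modelOp B 0 1 (B μ)) (B ν) : ℂ) =
      inner ℂ (B μ) (modelOp B 0 (-1) (B ν)) := by
  rw [(gzAction_model B).c1_plus, (gzAction_model B).c1_minus]
  simp only [inner_sub_left, inner_sub_right, inner_smul_left, inner_smul_right, inner_ket_left B hB,
    inner_ket_right B hB, Complex.conj_ofReal]
  congr 1
  · by_cases h : μ.m12 + 1 = ν.m12 ∧ μ.m22 = ν.m22 ∧ μ.m11 + 1 = ν.m11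
    · obtain ⟨h1, h2, h3⟩ := h
      rw [if_pos ⟨h1, h2, h3⟩, if_pos (by omega)]
      have ht : ν.theta = μ.theta := by unfold GZLabel.theta; omega
      rw [ht, ← h1, ← h2, add_sub_cancel_right]
      push_cast
      ring_nf
    · rw [if_neg h, if_neg (by omega), mul_zero, mul_zero]
  · by_cases h : μ.m12 = ν.m12 ∧ μ.m22 + 1 = ν.m22 ∧ μ.m11 + 1 = ν.m11
    · obtain ⟨h1, h2, h3⟩ := h
      rw [if_pos ⟨h1, h2, h3⟩, if_pos (by omega)]
      have ht : μ.theta = 1 ∧ ν.theta = 0 := by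
        have := theta_eq μ
        have := theta_eq ν
        omega
      rw [ht.1, ht.2, ← h1, ← h2, add_sub_cancel_right]
      push_cast
      ring_nf
    · rw [if_neg h, if_neg (by omega), mul_zero, mul_zero]

include hB in
theorem inner_modelOp_two_plus (μ ν : GZLabel p) :
    (inner ℂ (modelOp B 1 1 (B μ)) (B ν) : ℂ) =
      inner ℂ (B μ) (modelOp B 1 (-1) (B ν)) := by
  rw [(gzAction_model B).c2_plus, (gzAction_model B).c2_minus]
  simp only [inner_add_left, inner_add_right, inner_smul_left, inner_smul_right, inner_ket_left B hB,
    inner_ket_right B hB, Complex.conj_ofReal]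
  congr 1
  · by_cases h : μ.m12 + 1 = ν.m12 ∧ μ.m22 = ν.m22 ∧ μ.m11 = ν.m11
    · obtain ⟨h1, h2, h3⟩ := h
      rw [if_pos ⟨h1, h2, h3⟩, if_pos (by omega)]
      have ht : μ.theta = 0 ∧ ν.theta = 1 := by
        have := theta_eq μ
        have := theta_eq ν
        omega
      rw [ht.1, ht.2, ← h1, ← h2, add_sub_cancel_right]
      push_cast
      ring_nf
    · rw [if_neg h, if_neg (by omega), mul_zero, mul_zero]
  · by_cases h : μ.m12 = ν.m12 ∧ μ.m22 + 1 = ν.m22 ∧ μ.m11 = ν.m11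
    · obtain ⟨h1, h2, h3⟩ := h
      rw [if_pos ⟨h1, h2, h3⟩, if_pos (by omega)]
      have ht : ν.theta = μ.theta := by unfold GZLabel.theta; omega
      rw [ht, ← h1, ← h2, ← h3, add_sub_cancel_right]
      push_cast
      ring_nf
    · rw [if_neg h, if_neg (by omega), mul_zero, mul_zero]

theorem isAdj_of_basis {A A' : Module.End ℂ V}
    (h : ∀ μ ν, (inner ℂ (A (B μ)) (B ν) : ℂ) =
      inner ℂ (B μ) (A' (B ν))) : IsAdj A A' := by
  intro x y
  have hx : x ∈ Submodule.span ℂ (Set.range B) := B.span_eq ▸ trivial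
  have hy : y ∈ Submodule.span ℂ (Set.range B) := B.span_eq ▸ trivial
  induction hx, hy using Submodule.span_induction₂ with
  | mem_mem x y hx hy =>
    obtain ⟨μ, rfl⟩ := hx
    obtain ⟨ν, rfl⟩ := hy
    exact h μ ν
  | zero_left => simp
  | zero_right => simp
  | add_left x y z _ _ _ h1 h2 => rw [map_add, inner_add_left, inner_add_left, h1, h2]
  | add_right x y z _ _ _ h1 h2 => rw [map_add, inner_add_right, inner_add_right, h1, h2]
  | smul_left r x y _ _ h => rw [map_smul, inner_smul_left, inner_smul_left, h]
  | smul_right r x y _ _ h => rw [map_smul, inner_smul_right, inner_smul_right, h]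

theorem IsAdj.symm {A A' : Module.End ℂ V} (h : IsAdj A A') : IsAdj A' A := fun x y => by
  rw [← inner_conj_symm, ← h, inner_conj_symm]

include hB in
theorem modelOp_adjoint (j : Fin 2) (ξ : ℤˣ) : IsAdj (modelOp B j ξ) (modelOp B j (-ξ)) := by
  have h0 := isAdj_of_basis B (inner_modelOp_one_plus B hB)
  have h1 := isAdj_of_basis B (inner_modelOp_two_plus B hB)
  fin_cases j <;> rcases Int.units_eq_one_or ξ with rfl | rfl
  · exact h0
  · exact h0.symm
  · exact h1
  · exact h1.symm

variable (hp : 1 ≤ p)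

/-- The parastatistics Fock space of order `p`. -/
def modelFock : ParaFockSpace p V where
  c := modelOp B
  vac := B (vacLabel p)
  relations := (gzAction_model B).paraRelations hp B.span_eq (modelOp_adjoint B hB)
  vac_inner := by
    rw [inner_self_eq_norm_sq_to_K, (hB).1]
    simp
  annihilate j := by
    fin_cases j
    · exact (gzAction_model B).c1_minus_vac
    · exact (gzAction_model B).c2_minus_vac
  adjoint j ξ := modelOp_adjoint B hB j ξ
  order j k := by
    have H := gzAction_model B
    fin_cases j <;> fin_cases k <;>
      simp [superBracket, H.c1_minus_vac, H.c2_minus_vac, H.c1_plus_vac, H.c2_plus_vac,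
        H.c1_minus_fE0_one_zero hp, H.c1_minus_fE1_one_zero hp, H.c2_minus_fE0_one_zero hp,
        H.c2_minus_fE1_one_zero hp]
  irreducible := (gzAction_model B).irreducible (hB)
    B.span_eq (modelOp_adjoint B hB)

theorem isGZBasis_model : IsGZBasis (modelFock B hB hp) B where
  orthonormal := hB
  span_eq_top := B.span_eq
  vac_eq := rfl
  c1_plus := (gzAction_model B).c1_plus
  c2_plus := (gzAction_model B).c2_plus
  c1_minus := (gzAction_model B).c1_minus
  c2_minus := (gzAction_model B).c2_minus

end Model

/-! ### Eigenvalues of `M_3` and the angular momentum algebra -/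

section Spectrum

variable {p : ℕ} {V : Type*} [NormedAddCommGroup V] [InnerProductSpace ℂ V]
  {F : ParaFockSpace p V} {e : GZLabel p → V}

theorem GZAction.cartan1_apply {c : Fin 2 → ℤˣ → Module.End ℂ V} (H : GZAction p c e)
    (hp : 1 ≤ p) (μ : GZLabel p) : cartan1 c (e μ) = (p - 2 * μ.m11 : ℂ) • e μ := by
  rcases exists_rescaled e μ with rfl | ⟨-, -, n, -, r, h⟩
  · rw [H.cartan1_vac hp]
    simp [vacLabel]
  · rcases h with ⟨h, hm⟩ | ⟨h, hm⟩ | ⟨h, hm⟩ | ⟨h, hm⟩ <;> rw [h, map_smul, hm]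
    · rw [(H.cartan1_rescaled hp _ _).1.1, smul_comm]
    · rw [(H.cartan1_rescaled hp _ _).2.1, smul_comm]
    · rw [(H.cartan1_rescaled hp _ _).1.2, smul_comm]
      push_cast
      rfl
    · rw [(H.cartan1_rescaled hp _ _).2.2, smul_comm]
      push_cast
      rfl

namespace IsGZBasis

theorem M3_apply (he : IsGZBasis F e) (hp : 1 ≤ p) (μ : GZLabel p) :
    F.M3 (e μ) = ((p : ℂ) / 2 - (μ.m11 : ℂ)) • e μ := by
  have : F.M3 = (1 / 2 : ℂ) • cartan1 F.c := rfl
  rw [this, LinearMap.smul_apply, he.gzAction.cartan1_apply hp, smul_smul]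
  congr 1
  ring

theorem h1_apply (he : IsGZBasis F e) (hp : 1 ≤ p) (μ : GZLabel p) :
    F.h1 (e μ) = (-(p : ℂ) / 2 + (μ.m11 : ℂ)) • e μ := by
  have : F.h1 = (-1 / 2 : ℂ) • cartan1 F.c := rfl
  rw [this, LinearMap.smul_apply, he.gzAction.cartan1_apply hp, smul_smul]
  congr 1
  ring

theorem exists_inner_ne_zero (he : IsGZBasis F e) {x : V} (hx : x ≠ 0) :
    ∃ μ, (inner ℂ (e μ) x : ℂ) ≠ 0 := by
  by_contra! h
  refine hx ((inner_self_eq_zero (𝕜 := ℂ)).1 ?_)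
  have : ∀ y ∈ Submodule.span ℂ (Set.range e), (inner ℂ y x : ℂ) = 0 := by
    intro y hy
    induction hy using Submodule.span_induction with
    | mem y h' =>
      obtain ⟨μ, rfl⟩ := h'
      exact h μ
    | zero => simp
    | add u v _ _ hu hv => rw [inner_add_left, hu, hv, add_zero]
    | smul r u _ hu => rw [inner_smul_left, hu, mul_zero]
  exact this x (he.span_eq_top ▸ trivial)

end IsGZBasis

theorem ParaFockSpace.isAdj (F : ParaFockSpace p V) (j : Fin 2) (ξ : ℤˣ) :
    IsAdj (F.c j ξ) (F.c j (-ξ)) := F.adjoint j ξ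

theorem ParaFockSpace.isAdj_M3 (F : ParaFockSpace p V) : IsAdj F.M3 F.M3 := by
  have h := F.isAdj 0 1
  have := ((h.symm.mul h).sub (h.mul h.symm)).smul (1 / 2)
  have h2 : (((1 / 2 : ℝ)) : ℂ) = 1 / 2 := by push_cast; rfl
  rwa [h2] at this

theorem IsGZBasis.inner_M3 (he : IsGZBasis F e) (hp : 1 ≤ p) (μ : GZLabel p) (x : V) :
    (inner ℂ (e μ) (F.M3 x) : ℂ) = ((p : ℂ) / 2 - (μ.m11 : ℂ)) * inner ℂ (e μ) x := by
  have : ((p : ℂ) / 2 - (μ.m11 : ℂ)) = (((p : ℝ) / 2 - (μ.m11 : ℝ) : ℝ) : ℂ) := by push_cast; rfl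
  rw [← F.isAdj_M3, he.M3_apply hp, inner_smul_left, this, Complex.conj_ofReal]

theorem m11_mem (μ : GZLabel p) : 0 ≤ μ.m11 ∧ μ.m11 ≤ p := by
  obtain ⟨h1, h2, h3, h4, h5, h6⟩ := μ.adm
  omega

theorem IsGZBasis.hasEigenvalue_M3 (he : IsGZBasis F e) (hp : 1 ≤ p) (z : ℂ) :
    F.M3.HasEigenvalue z ↔ ∃ k : ℕ, k ≤ p ∧ z = (p : ℂ) / 2 - (k : ℂ) := by
  constructor
  · intro h
    obtain ⟨x, hx⟩ := h.exists_hasEigenvector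
    obtain ⟨μ, hμ⟩ := he.exists_inner_ne_zero hx.2
    have h1 := he.inner_M3 hp μ x
    rw [hx.apply_eq_smul, inner_smul_right] at h1
    obtain ⟨h2, h3⟩ := m11_mem μ
    refine ⟨μ.m11.toNat, by omega, ?_⟩
    rw [mul_right_cancel₀ hμ h1]
    congr 1
    exact_mod_cast congrArg (Int.cast (R := ℂ)) (Int.toNat_of_nonneg h2).symm
  · rintro ⟨k, hk, rfl⟩
    -- The vector `|k, 0; k)` realizes the eigenvalue `p/2 - k`.
    have hA : Admissible p k 0 k := by
      refine ⟨le_rfl, ?_, ?_, ?_, ?_, ?_⟩ <;> omega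
    refine Module.End.hasEigenvalue_of_hasEigenvector (x := e ⟨k, 0, k, hA⟩)
      ⟨Module.End.mem_eigenspace_iff.2 ?_, he.orthonormal.ne_zero _⟩
    rw [he.M3_apply hp]
    simp

namespace ParaFockSpace

variable (F)

/-- The sum `M_1² + M_2²` is half the anticommutator of `c_1^±`, and `[c_1^-, c_1^+] = 2 M_3`. On
vectors killed by `c_1^-` this leaves `M_3 (M_3 + 1)`. -/
theorem Msq_eq : F.Msq = F.M3 * F.M3 + F.M3 + F.c 0 1 * F.c 0 (-1) := by
  have hI : (-Complex.I / 2) * (-Complex.I / 2) = -(1 / 4 : ℂ) := by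
    linear_combination (1 / 4 : ℂ) * Complex.I_mul_I
  simp only [Msq, M1, M2, M3, smul_mul_smul_comm, hI, add_mul, mul_add, sub_mul, mul_sub]
  module

/-- Thus `c_1^-` is the raising operator for `M_3`, and the vacuum is a highest weight vector. -/
theorem M3_mul_c_minus : F.M3 * F.c 0 (-1) = F.c 0 (-1) * F.M3 + F.c 0 (-1) := by
  have h := F.relations 0 0 0 (-1) 1 (-1)
  have h1 : (-1 : ℤˣ) ≠ 1 := by decide
  simp [superBracket, deg, h1] at h
  simp only [M3, smul_mul_assoc, mul_smul_comm]
  linear_combination (norm := module) (1 / 2 : ℂ) • h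

theorem c_minus_mul_c_plus :
    F.c 0 (-1) * F.c 0 1 = (2 : ℂ) • F.M3 + F.c 0 1 * F.c 0 (-1) := by
  simp only [M3]
  module

theorem Msq_mul_c_minus : F.Msq * F.c 0 (-1) = F.c 0 (-1) * F.Msq := by
  have h := F.M3_mul_c_minus
  have h2 := congrArg (F.M3 * ·) h
  have h3 := congrArg (· * F.M3) h
  have h4 := congrArg (· * F.c 0 (-1)) F.c_minus_mul_c_plus
  simp only [mul_add, add_mul, mul_assoc, smul_mul_assoc] at h2 h3 h4
  simp only [Msq_eq, mul_add, add_mul, mul_assoc]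
  linear_combination (norm := module) h2 + h3 - h4

end ParaFockSpace

end Spectrum

/-! ### The maximal angular momentum -/

section AngularMomentum

variable {p : ℕ} {V : Type*} [NormedAddCommGroup V] [InnerProductSpace ℂ V]
  {F : ParaFockSpace p V} {e : GZLabel p → V}

namespace IsGZBasis

variable (he : IsGZBasis F e) (hp : 1 ≤ p)
include he hp

theorem M3_c_minus_pow (μ : GZLabel p) (n : ℕ) :
    F.M3 ((F.c 0 (-1) ^ n) (e μ)) =
      ((p : ℂ) / 2 - (μ.m11 : ℂ) + n) • (F.c 0 (-1) ^ n) (e μ) := by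
  induction n with
  | zero => simpa using he.M3_apply hp μ
  | succ n ih =>
    have h := congrArg (fun T : Module.End ℂ V => T ((F.c 0 (-1) ^ n) (e μ))) F.M3_mul_c_minus
    simp only [Module.End.mul_apply, LinearMap.add_apply, ih, map_smul] at h
    rw [pow_succ', Module.End.mul_apply, h]
    push_cast
    module

/-- After `p + 1` raisings the `M_3`-eigenvalue would be `p/2 - μ_11 + p + 1`, which exceeds the
maximum `p/2` because `μ_11 ≤ p`. -/
theorem c_minus_pow_eq_zero : F.c 0 (-1) ^ (p + 1) = 0 := by
  refine LinearMap.ext_on_range he.span_eq_top fun μ => ?_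
  by_contra hne
  rw [LinearMap.zero_apply] at hne
  obtain ⟨k, -, hk⟩ := (he.hasEigenvalue_M3 hp _).1 (Module.End.hasEigenvalue_of_hasEigenvector
    ⟨Module.End.mem_eigenspace_iff.2 (he.M3_c_minus_pow hp μ (p + 1)), hne⟩)
  have h1 : ((p + 1 + k : ℤ) : ℂ) = (μ.m11 : ℂ) := by
    push_cast at hk ⊢
    linear_combination hk
  have h2 : (p + 1 + k : ℤ) = μ.m11 := by exact_mod_cast h1
  have := (m11_mem μ).2
  omega

theorem hasEigenvalue_Msq : F.Msq.HasEigenvalue (((p : ℝ) / 2 * ((p : ℝ) / 2 + 1) : ℝ) : ℂ) := by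
  refine Module.End.hasEigenvalue_of_hasEigenvector (x := F.vac)
    ⟨Module.End.mem_eigenspace_iff.2 ?_, F.vac_ne_zero⟩
  have h := he.M3_apply hp (vacLabel p)
  rw [he.vac_eq] at h
  rw [F.Msq_eq]
  simp only [LinearMap.add_apply, Module.End.mul_apply, F.annihilate, map_zero, h, map_smul,
    vacLabel]
  push_cast
  module

theorem le_of_hasEigenvalue_Msq {j : ℝ} (hj : 0 ≤ j)
    (h : F.Msq.HasEigenvalue ((j * (j + 1) : ℝ) : ℂ)) : j ≤ p / 2 := by
  obtain ⟨x, hx⟩ := h.exists_hasEigenvector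
  -- Raise the eigenvector of `M²` as long as it stays nonzero; the last vector is killed by `c_1^-`
  -- and has the same `M²`-eigenvalue.
  obtain ⟨n, hn, hn'⟩ : ∃ n, (F.c 0 (-1) ^ n) x ≠ 0 ∧ (F.c 0 (-1) ^ (n + 1)) x = 0 := by
    classical
    have hex : ∃ n, (F.c 0 (-1) ^ n) x = 0 :=
      ⟨p + 1, by rw [he.c_minus_pow_eq_zero hp, LinearMap.zero_apply]⟩
    obtain ⟨n, hn⟩ : ∃ n, Nat.find hex = n + 1 := Nat.exists_eq_succ_of_ne_zero fun h0 => by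
      have := Nat.find_spec hex
      rw [h0] at this
      exact hx.2 (by simpa using this)
    exact ⟨n, Nat.find_min hex (by omega), hn ▸ Nat.find_spec hex⟩
  set y := (F.c 0 (-1) ^ n) x with hy
  have h1 : F.Msq y = ((j * (j + 1) : ℝ) : ℂ) • y := by
    have hc : Commute F.Msq (F.c 0 (-1) ^ n) :=
      Commute.pow_right (show Commute F.Msq (F.c 0 (-1)) from F.Msq_mul_c_minus) n
    have := congrArg (fun T : Module.End ℂ V => T x) hc.eq
    simp only [Module.End.mul_apply, hx.apply_eq_smul, map_smul] at this
    exact this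
  have h2 : F.c 0 (-1) y = 0 := by rwa [pow_succ', Module.End.mul_apply] at hn'
  rw [F.Msq_eq, LinearMap.add_apply, LinearMap.add_apply, Module.End.mul_apply,
    Module.End.mul_apply, h2, map_zero, add_zero] at h1
  obtain ⟨μ, hμ⟩ := he.exists_inner_ne_zero hn
  have h3 := congrArg (fun z => (inner ℂ (e μ) z : ℂ)) h1
  simp only [inner_add_right, inner_smul_right, he.inner_M3 hp] at h3
  have h4 : ((p : ℂ) / 2 - μ.m11) * ((p : ℂ) / 2 - μ.m11 + 1) = ((j * (j + 1) : ℝ) : ℂ) := by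
    refine mul_right_cancel₀ hμ ?_
    linear_combination h3
  have h5 : ((p : ℝ) / 2 - μ.m11) * ((p : ℝ) / 2 - μ.m11 + 1) = j * (j + 1) := by
    apply Complex.ofReal_injective
    rw [← h4]
    push_cast
    rfl
  have h6 : (0 : ℝ) ≤ μ.m11 := by exact_mod_cast (m11_mem μ).1
  have h7 : (μ.m11 : ℝ) ≤ p := by exact_mod_cast (m11_mem μ).2
  by_contra! hlt
  -- With `m = p/2 - μ_11`, the product supplied is `p/2 (p/2 + 1) - m (m + 1) = μ_11 (p - μ_11 + 1)
  -- ≥ 0`, while `j > p/2` would make `j (j + 1)` larger than `p/2 (p/2 + 1)`.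
  nlinarith [mul_nonneg h6 (by linarith : (0 : ℝ) ≤ p - μ.m11 + 1)]

end IsGZBasis

end AngularMomentum

end Osp32
end

open Osp32 in
theorem mainTheorem4 (p : ℕ) (hp : 1 ≤ p) :
    -- the parastatistics Fock space of order `p` exists
    (∃ (V : Type) (_ : NormedAddCommGroup V) (_ : InnerProductSpace ℂ V),
      Nonempty (Osp32.ParaFockSpace p V)) ∧
    -- and for each realization of it:
    ∀ (V : Type*) [NormedAddCommGroup V] [InnerProductSpace ℂ V] (F : Osp32.ParaFockSpace p V),
      -- the basis of the vectors `|μ)` exists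
      (∃ e : Osp32.GZLabel p → V, Osp32.IsGZBasis F e) ∧
      -- each `|μ)` is an eigenvector of `h_1` and of `M_3 = -h_1`, with these eigenvalues
      (∀ e : Osp32.GZLabel p → V, Osp32.IsGZBasis F e → ∀ μ : Osp32.GZLabel p,
        F.h1.HasEigenvector (-(p : ℂ) / 2 + (μ.m11 : ℂ)) (e μ) ∧
        F.M3.HasEigenvector ((p : ℂ) / 2 - (μ.m11 : ℂ)) (e μ)) ∧
      -- the spectrum of `M_3` is `p/2, p/2 - 1, …, -p/2`
      {z : ℂ | F.M3.HasEigenvalue z} = {z : ℂ | ∃ k : ℕ, k ≤ p ∧ z = (p : ℂ) / 2 - (k : ℂ)} ∧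
      -- the greatest total angular momentum quantum number is `p/2`
      IsGreatest {j : ℝ | 0 ≤ j ∧ F.Msq.HasEigenvalue ((j * (j + 1) : ℝ) : ℂ)} ((p : ℝ) / 2) := by
  obtain ⟨V₀, _, _, B, hB⟩ := exists_orthonormal_basis (GZLabel p)
  refine ⟨⟨V₀, inferInstance, inferInstance, ⟨modelFock B hB hp⟩⟩, ?_⟩
  intro V _ _ F
  obtain ⟨e, he⟩ := exists_isGZBasis_of_isGZBasis (modelFock B hB hp) F (isGZBasis_model B hB hp)
  refine ⟨⟨e, he⟩, fun e he μ => ⟨?_, ?_⟩, ?_, ?_, ?_⟩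
  · exact ⟨Module.End.mem_eigenspace_iff.2 (he.h1_apply hp μ), he.orthonormal.ne_zero μ⟩
  · exact ⟨Module.End.mem_eigenspace_iff.2 (he.M3_apply hp μ), he.orthonormal.ne_zero μ⟩
  · exact Set.ext fun z => he.hasEigenvalue_M3 hp z
  · exact ⟨by positivity, he.hasEigenvalue_Msq hp⟩
  · exact fun j hj => he.le_of_hasEigenvalue_Msq hp hj.1 hj.2
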